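/- Theorem. Let $M\subset\mathbb R^N$ be a closed path-connected set with positive reach $\tau_M\in(0,\infty]$, where $\tau_M$ is the supremum of all $r>0$ such that every point at distance less than $r$ from $M$ has a unique nearest point in $M$. Let $f:\mathbb R^N\to\mathbb R$ be $\kappa$-Lipschitz ($\kappa\ge 0$) with $f\ge f_{\min}$ for some $f_{\min}>0$. For $x,y\in M$ let $$D_{M,f}(x,y)=\inf_\gamma\int_a^b f(\gamma(t))\,\|\dot\gamma(t)\|\,dt ,$$ the infimum being over all Lipschitz paths $\gamma:[a,b]\to M$, $a<b$, with $\gamma(a)=x$ and $\gamma(b)=y$, and let $$\mathcal T_{M,f}=\min\Big(\frac{\tau_M}{2},\frac{f_{\min}}{8\kappa}\Big)\in(0,\infty],$$ where $f_{\min}/(8\kappa)=\infty$ if $\kappa=0$. For $x,y\in\mathbb R^N$ define the weights of resolution $q\in\{2,3,\dots\}\cup\{\infty\}$ by $$w_{f,q}(x,y)=\frac{\|x-y\|}{2(q-1)}\Big(f(x)+2\sum_{k=2}^{q-1}f\Big(\tfrac{q-k}{q-1}x+\tfrac{k-1}{q-1}y\Big)+f(y)\Big)\quad(q<\infty),$$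 $$w_{f,\infty}(x,y)=\|x-y\|\int_0^1 f((1-t)x+ty)\,dt .$$ Let $X\subset M$ be a finite set and $r>0$. For $x,y\in M$ let $$\widehat D_{X,f}(x,y)=\min_{(x_0,\dots,x_K)}\sum_{k=0}^{K-1}w_{f,q}(x_k,x_{k+1}),$$ the minimum being over all finite sequences of points of $X\cup\{x,y\}$ with $x_0=x$, $x_K=y$ and $\|x_k-x_{k+1}\|\le r$ for all $k<K$ (that is, over the paths from $x$ to $y$ in the $r$-ball graph on $X\cup\{x,y\}$), and $\widehat D_{X,f}(x,y)=\infty$ if there is no such sequence. Let $d_H(M,X)$ be the Hausdorff distance (infinite if $X=\emptyset$). If $$4\,d_H(M,X)\le r\le\mathcal T_{M,f},$$ then $$\sup_{x\ne y\in M}\left|1-\frac{\widehat D_{X,f}(x,y)}{D_{M,f}(x,y)}\right|\le\frac{r}{32\,\mathcal T_{M,f}\,(q-1)}+\frac{r^2}{8\,\mathcal T_{M,f}^2}+56\,\frac{d_H(M,X)^2}{r^2},$$ where the first term is $0$ if $q=\infty$, the first two terms are $0$ if $\mathcal T_{M,f}=\infty$, and the left-hand side is $\infty$ if $\widehat D_{X,f}$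 takes the value $\infty$. -/

import Mathlib

open MeasureTheory
open scoped ENNReal NNReal

namespace ConformalGraph

noncomputable section

/-- The reach of a subset `M` of `ℝ^N`, with values in `[0, ∞]`: the supremum of all `r` such that
every point at distance less than `r` from `M` has a unique nearest point in `M`. -/
def reach {N : ℕ} (M : Set (EuclideanSpace ℝ (Fin N))) : ℝ≥0∞ :=
  sSup {r : ℝ≥0∞ | ∀ x : EuclideanSpace ℝ (Fin N), Metric.infEDist x M < r →
    ∃! y : EuclideanSpace ℝ (Fin N), y ∈ M ∧ edist x y = Metric.infEDist x M}

/-- `γ`, restricted to the nontrivial segment `[a, b]`, is a Lipschitz path in `M`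
from `x` to `y`. -/
structure IsLipschitzPath {N : ℕ} (M : Set (EuclideanSpace ℝ (Fin N)))
    (x y : EuclideanSpace ℝ (Fin N)) (a b : ℝ) (γ : ℝ → EuclideanSpace ℝ (Fin N)) : Prop where
  lt : a < b
  lipschitz : ∃ K : ℝ≥0, LipschitzOnWith K γ (Set.Icc a b)
  mapsTo : Set.MapsTo γ (Set.Icc a b) M
  source : γ a = x
  target : γ b = y

/-- The conformal length `∫_a^b f(γ(t)) ‖γ'(t)‖ dt`. A Lipschitz path is differentiable almost
everywhere on `[a, b]`, so the values of `deriv` at other points play no role. -/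
def conformalLength {N : ℕ} (f : EuclideanSpace ℝ (Fin N) → ℝ) (a b : ℝ)
    (γ : ℝ → EuclideanSpace ℝ (Fin N)) : ℝ≥0∞ :=
  ∫⁻ t in Set.Icc a b, ENNReal.ofReal (f (γ t) * ‖deriv γ t‖)

/-- The conformal distance `D_{M,f}(x, y)`: the infimum of the conformal lengths of the Lipschitz
paths in `M` from `x` to `y`. -/
def conformalDist {N : ℕ} (M : Set (EuclideanSpace ℝ (Fin N)))
    (f : EuclideanSpace ℝ (Fin N) → ℝ) (x y : EuclideanSpace ℝ (Fin N)) : ℝ≥0∞ :=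
  ⨅ (a : ℝ) (b : ℝ) (γ : ℝ → EuclideanSpace ℝ (Fin N)) (_ : IsLipschitzPath M x y a b γ),
    conformalLength f a b γ

/-- The constant `min (τ_M / 2) (f_min / (8 κ))` in `[0, ∞]`; the second term is `∞` when `κ = 0`
and `f_min > 0`. -/
def reachBound {N : ℕ} (M : Set (EuclideanSpace ℝ (Fin N))) (fmin : ℝ) (κ : ℝ≥0) : ℝ≥0∞ :=
  min (reach M / 2) (ENNReal.ofReal fmin / (8 * (κ : ℝ≥0∞)))

/-- The weight `w_{f,q}(x, y)` of resolution `q ∈ {2, 3, …, ∞}`. -/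
def weight {N : ℕ} (f : EuclideanSpace ℝ (Fin N) → ℝ) (q : ℕ∞)
    (x y : EuclideanSpace ℝ (Fin N)) : ℝ :=
  match q with
  | ⊤ => ‖x - y‖ * ∫ t in (0 : ℝ)..1, f ((1 - t) • x + t • y)
  | (n : ℕ) => ‖x - y‖ / (2 * ((n : ℝ) - 1)) *
      (f x
        + 2 * ∑ k ∈ Finset.Icc 2 (n - 1),
            f ((((n : ℝ) - (k : ℝ)) / ((n : ℝ) - 1)) • x
              + (((k : ℝ) - 1) / ((n : ℝ) - 1)) • y)
        + f y)

/-- `(p 0, …, p K)` is a path from `x` to `y` in the `r`-ball graph over the vertex set `V`: all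
`p k` are vertices, and consecutive ones are at distance at most `r`. (A repeated vertex
contributes an edge of weight `0`.) -/
structure IsBallGraphPath {N : ℕ} (V : Set (EuclideanSpace ℝ (Fin N))) (r : ℝ)
    (x y : EuclideanSpace ℝ (Fin N)) (K : ℕ) (p : ℕ → EuclideanSpace ℝ (Fin N)) : Prop where
  source : p 0 = x
  target : p K = y
  vertex : ∀ k ≤ K, p k ∈ V
  edge : ∀ k < K, ‖p k - p (k + 1)‖ ≤ r

/-- The polygonal metric: the least total weight of a path from `x` to `y` in the `r`-ball graph
over `X ∪ {x, y}` with weights of resolution `q`, and `∞` when there is no such path. -/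
def polygonalDist {N : ℕ} (X : Set (EuclideanSpace ℝ (Fin N)))
    (f : EuclideanSpace ℝ (Fin N) → ℝ) (r : ℝ) (q : ℕ∞)
    (x y : EuclideanSpace ℝ (Fin N)) : ℝ≥0∞ :=
  ⨅ (K : ℕ) (p : ℕ → EuclideanSpace ℝ (Fin N)) (_ : IsBallGraphPath (X ∪ {x, y}) r x y K p),
    ENNReal.ofReal (∑ k ∈ Finset.range K, weight f q (p k) (p (k + 1)))

/-- The relative loss `sup_{x ≠ y ∈ M} |1 - D'(x, y) / D(x, y)|` in `[0, ∞]`. Since subtraction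
in `[0, ∞]` is truncated at `0`, `|1 - a|` is written `max (1 - a) (a - 1)`; it is `∞` when
`D'(x, y) = ∞` and `D(x, y)` is finite. -/
def relLoss {N : ℕ} (M : Set (EuclideanSpace ℝ (Fin N)))
    (D' D : EuclideanSpace ℝ (Fin N) → EuclideanSpace ℝ (Fin N) → ℝ≥0∞) : ℝ≥0∞ :=
  ⨆ (x ∈ M) (y ∈ M) (_ : x ≠ y), max (1 - D' x y / D x y) (D' x y / D x y - 1)

end

end ConformalGraph

/-!
The polygonal metric is compared with the conformal distance edge by edge, at a finite scale `T`
with `r ≤ T`, `2 * T ≤ reach M` and `8 * κ * T ≤ fmin` (`AdmissibleScale`). If `reachBound M fmin κ`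
is finite it is itself such a scale; otherwise every `T ≥ r` is, and `T` tends to infinity.

*Reach.* Where nearest points are unique at distance less than `τ` from `M`, a nearest point stays
nearest when one moves away along the normal ray, up to distance `τ`
(`UniqueNearest.infDist_ray`). So `M` avoids the balls of radius `τ` tangent to it
(`UniqueNearest.inner_le`), the nearest-point map has Lipschitz constant `1 / (1 - ρ / τ)` at
distance at most `ρ` from `M`, and a chord of length `ℓ` stays within `O(ℓ ^ 2 / τ)` of `M`.

*Short edges.* Let `u`, `v` be points of `M` at distance `ℓ ≤ T`, and let `I` be the weight of
infinite resolution of the segment. The projection of the segment to `M` is a path whose conformal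
length is at most `(1 + ℓ ^ 2 / (20 * T ^ 2)) * I` (`AdmissibleScale.conformalDist_le`). Conversely
a curve from `u` to `v` that departs from the line through `u` and `v` by `H ≤ ℓ` gains at most
`κ * H * ℓ`, but its excess length, at least of order `H ^ 2 / ℓ`, costs `fmin` per unit; hence
`I ≤ (1 + ℓ ^ 2 / (256 * T ^ 2)) * D(u, v)` (`LipschitzOnWith.chord_integral_le_mul`). The
trapezoidal rule changes `I` by at most `κ * ℓ ^ 2 / (4 * (q - 1))`, which is the first term of the
bound. Summing over the edges of a path in the graph gives the lower bound for the polygonal metric.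

*Upper bound.* If `‖x - y‖ < r / 3`, a single edge is enough. Otherwise, by compactness, there are
points `p₀ = x, p₁, …, p_K = y` of `M`, at consecutive distances between `r / 3` and `2 * r / 3`,
along which the conformal distance is additive (`AdmissibleScale.exists_realDist_add_eq`). Replace
each interior `pₖ` by a point `zₖ` of `X` at distance at most `ε = d_H(M, X)`. The linear part of
the change of the total weight is a telescoping sum: it leaves the inner products of `zₖ - pₖ` with
the differences of the weighted directions of consecutive edges. Shortest paths turn by `O(r / T)`
from one edge to the next (`AdmissibleScale.norm_direction_sub_le`), since a larger turn would
contradict the second-order estimates for short edges. The linear part is thus of relative size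
`O((ε / r) * (r / T))`, which is absorbed by `r ^ 2 / (8 * T ^ 2)` and `56 * (ε / r) ^ 2`, as are
the quadratic terms.
-/

/-! ### Sets of positive reach -/

section Reach

open Metric

/-- `UniqueNearest M τ`: every point at distance less than `τ` from `M` has at most one nearest
point in `M`. -/
def UniqueNearest {V : Type*} [MetricSpace V] (M : Set V) (τ : ℝ) : Prop :=
  ∀ x, infDist x M < τ → ∀ p ∈ M, ∀ q ∈ M,
    dist x p = infDist x M → dist x q = infDist x M → p = q

/-- The nearest-point map is continuous at points with a unique nearest point. -/
theorem UniqueNearest.dist_nearest_lt {V : Type*} [MetricSpace V] [ProperSpace V]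
    {M : Set V} {τ : ℝ} (hM : IsClosed M)
    (hU : UniqueNearest M τ) {x p : V} (hx : infDist x M < τ) (hp : p ∈ M)
    (hxp : dist x p = infDist x M) {ε : ℝ} (hε : 0 < ε) :
    ∃ η > 0, ∀ w q, dist w x < η → q ∈ M → dist w q = infDist w M → dist q p < ε := by
  set S : Set V := M ∩ {q | ε ≤ dist q p} with hS
  have hSc : IsClosed S := hM.inter (isClosed_le continuous_const (by fun_prop))
  rcases S.eq_empty_or_nonempty with h0 | h0
  · refine ⟨1, one_pos, fun w q _ hq _ => ?_⟩
    by_contra! h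
    exact (h0 ▸ (⟨hq, h⟩ : q ∈ S) : q ∈ (∅ : Set V))
  · obtain ⟨q₀, hq₀, hd⟩ := hSc.exists_infDist_eq_dist h0 x
    have hlt : infDist x M < dist x q₀ := by
      refine lt_of_le_of_ne (infDist_le_dist_of_mem hq₀.1) fun h => ?_
      have := hU x hx p hp q₀ hq₀.1 hxp h.symm
      have h2 : ε ≤ dist q₀ p := hq₀.2
      rw [this, dist_self] at h2
      linarith
    refine ⟨(dist x q₀ - infDist x M) / 2, by linarith, fun w q hw hq hwq => ?_⟩
    by_contra! h
    have h1 : infDist x S ≤ dist x q := infDist_le_dist_of_mem ⟨hq, h⟩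
    have h2 : dist x q ≤ dist x w + dist w q := dist_triangle _ _ _
    have h3 : infDist w M ≤ infDist x M + dist w x := infDist_le_infDist_add_dist
    rw [dist_comm] at hw
    rw [dist_comm w x] at h3
    linarith

variable {V : Type*} [NormedAddCommGroup V] [InnerProductSpace ℝ V] [ProperSpace V]

/-- The distance to `M` grows at unit speed along the outward normal direction. -/
theorem UniqueNearest.infDist_growth {M : Set V} {τ : ℝ} (hM : IsClosed M) (hne : M.Nonempty)
    (hU : UniqueNearest M τ) {x p : V} (hx : infDist x M < τ) (hx0 : 0 < infDist x M) (hp : p ∈ M)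
    (hxp : dist x p = infDist x M) {c : ℝ} (hc0 : 0 ≤ c) (hc : c < 1) :
    ∃ η > 0, ∀ h, 0 < h → h < η →
      infDist x M + c * h < infDist (x + h • ((infDist x M)⁻¹ • (x - p))) M := by
  set δ := infDist x M with hδ
  obtain ⟨η, hη, H⟩ := hU.dist_nearest_lt hM hx hp hxp
    (ε := (1 - c) * δ) (mul_pos (by linarith) hx0)
  refine ⟨η, hη, fun h h0 h1 => ?_⟩
  set v := δ⁻¹ • (x - p) with hv
  have hnv : ‖v‖ = 1 := by
    rw [hv, norm_smul, ← dist_eq_norm, hxp, norm_inv, Real.norm_of_nonneg hx0.le]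
    field_simp
  obtain ⟨q, hq, hwq⟩ := hM.exists_infDist_eq_dist hne (x + h • v)
  have hqp : dist q p < (1 - c) * δ := by
    refine H (x + h • v) q ?_ hq hwq.symm
    rw [dist_eq_norm, add_sub_cancel_left, norm_smul, hnv, Real.norm_of_nonneg h0.le]
    linarith
  have hxq : δ ≤ ‖x - q‖ := by
    rw [← dist_eq_norm]; exact infDist_le_dist_of_mem hq
  have hvp : inner ℝ v (x - p) = δ := by
    rw [hv, real_inner_smul_left, real_inner_self_eq_norm_sq, ← dist_eq_norm, hxp]
    field_simp
  have hvq : c * δ < inner ℝ v (x - q) := by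
    have e : x - q = (x - p) - (q - p) := by abel
    have h2 : inner ℝ v (q - p) ≤ ‖v‖ * ‖q - p‖ := real_inner_le_norm _ _
    rw [hnv, ← dist_eq_norm, one_mul] at h2
    rw [e, inner_sub_right, hvp]
    linarith
  rw [hwq, dist_eq_norm]
  have e : x + h • v - q = (x - q) + h • v := by abel
  refine lt_of_pow_lt_pow_left₀ 2 (norm_nonneg _) ?_
  rw [e, norm_add_sq_real, real_inner_smul_right, norm_smul, hnv, Real.norm_of_nonneg h0.le,
    real_inner_comm]
  have h3 : δ ^ 2 ≤ ‖x - q‖ ^ 2 := by gcongr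
  have h4 : c ^ 2 ≤ 1 := by nlinarith
  nlinarith [mul_lt_mul_of_pos_left hvq h0, mul_le_mul_of_nonneg_right h4 (sq_nonneg h)]

/-- The nearest point `p` of `x` stays a nearest point when `x` is moved away from `p` along the
normal ray, up to distance `τ` from `M`. A point `z` of the sphere of radius `t` about `x` where
`infDist z M` is greatest has distance at least `infDist x M + t` from `M`, hence from `p`, and so
lies on the ray. -/
theorem UniqueNearest.infDist_ray {M : Set V} {τ : ℝ} (hM : IsClosed M) (hne : M.Nonempty)
    (hU : UniqueNearest M τ) {x p : V} (hx0 : 0 < infDist x M) (hp : p ∈ M)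
    (hxp : dist x p = infDist x M) {t : ℝ} (ht : 0 < t) (htτ : infDist x M + t < τ) :
    infDist (x + t • ((infDist x M)⁻¹ • (x - p))) M = infDist x M + t := by
  set δ := infDist x M with hδ
  set v := δ⁻¹ • (x - p) with hv
  have hnv : ‖v‖ = 1 := by
    rw [hv, norm_smul, ← dist_eq_norm, hxp, norm_inv, Real.norm_of_nonneg hx0.le]
    field_simp
  have hcd : Continuous fun z => infDist z M := continuous_infDist_pt M
  -- the slope `c < 1` makes a maximum inside the ball impossible
  have key : ∀ c : ℝ, 0 ≤ c → c < 1 → ∃ z ∈ sphere x t, δ + c * t ≤ infDist z M := by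
    intro c hc0 hc
    obtain ⟨z, hz, hmax⟩ := (isCompact_closedBall x t).exists_isMaxOn
      ⟨x, mem_closedBall_self ht.le⟩ (f := fun z => infDist z M - c * dist z x)
      (by fun_prop)
    have hzx : δ ≤ infDist z M - c * dist z x := by
      simpa using hmax (mem_closedBall_self ht.le)
    rcases (mem_closedBall.1 hz).eq_or_lt with he | hlt
    · exact ⟨z, he, by rw [he] at hzx; linarith⟩
    · exfalso
      have hz0 : 0 < infDist z M := by
        have : 0 ≤ c * dist z x := by positivity
        linarith
      have hzτ : infDist z M < τ := by
        have : infDist z M ≤ infDist x M + dist z x := infDist_le_infDist_add_dist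
        linarith
      obtain ⟨q, hq, hzq⟩ := hM.exists_infDist_eq_dist hne z
      obtain ⟨η, hη, H⟩ := hU.infDist_growth hM hne hzτ hz0 hq hzq.symm hc0 hc
      set h := min (η / 2) (t - dist z x) with hh
      have hh0 : 0 < h := lt_min (by linarith) (by linarith)
      have hhη : h < η := (min_le_left _ _).trans_lt (by linarith)
      have hgr := H h hh0 hhη
      set w := z + h • ((infDist z M)⁻¹ • (z - q)) with hw
      have hwz : dist w z = h := by
        rw [dist_eq_norm, hw, add_sub_cancel_left, norm_smul, norm_smul, ← dist_eq_norm, ← hzq,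
          norm_inv, Real.norm_of_nonneg hh0.le, Real.norm_of_nonneg hz0.le]
        field_simp
      have hwx : dist w x ≤ h + dist z x := by
        rw [← hwz]; exact dist_triangle _ _ _
      have hwb : w ∈ closedBall x t := by
        rw [mem_closedBall]
        have : h ≤ t - dist z x := min_le_right _ _
        linarith
      have : infDist w M - c * dist w x ≤ infDist z M - c * dist z x := hmax hwb
      nlinarith [mul_le_mul_of_nonneg_left hwx hc0]
  obtain ⟨z₀, hz₀, -⟩ := key 0 le_rfl one_pos
  obtain ⟨z, hz, hmax⟩ := (isCompact_sphere x t).exists_isMaxOn ⟨z₀, hz₀⟩ hcd.continuousOn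
  have hzd : δ + t ≤ infDist z M := by
    by_contra! h
    -- a slope `c` between the growth rate at `z` and `1`
    obtain ⟨c, hc1, hc2⟩ := exists_between
      (show max 0 ((infDist z M - δ) / t) < 1 by
        rw [max_lt_iff, div_lt_one ht]; exact ⟨one_pos, by linarith⟩)
    obtain ⟨hc0, hc3⟩ := max_lt_iff.1 hc1
    obtain ⟨w, hw, hwd⟩ := key c hc0.le hc2
    have h2 : infDist w M ≤ infDist z M := hmax hw
    rw [div_lt_iff₀ ht] at hc3
    linarith
  have hzp : δ + t ≤ ‖z - p‖ := hzd.trans (by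
    rw [← dist_eq_norm]; exact infDist_le_dist_of_mem hp)
  have hzt : ‖z - x‖ = t := by rw [← dist_eq_norm]; exact hz
  have hpx : ‖x - p‖ = δ := by rw [← dist_eq_norm]; exact hxp
  have hxpv : x - p = δ • v := by rw [hv, smul_smul, mul_inv_cancel₀ hx0.ne', one_smul]
  have e1 : z - p = (z - x) + (x - p) := by abel
  have h1 : (δ + t) ^ 2 ≤ ‖z - p‖ ^ 2 := by gcongr
  rw [e1, norm_add_sq_real, hzt, hpx, hxpv, real_inner_smul_right] at h1
  have h2 : t ≤ inner ℝ (z - x) v := by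
    have : δ * t ≤ δ * inner ℝ (z - x) v := by nlinarith
    exact le_of_mul_le_mul_left this hx0
  have h3 : ‖(z - x) - t • v‖ ^ 2 ≤ 0 := by
    rw [norm_sub_sq_real, hzt, real_inner_smul_right, norm_smul, hnv, Real.norm_of_nonneg ht.le]
    nlinarith
  have h4 : z = x + t • v := by
    have : ‖(z - x) - t • v‖ = 0 := by
      have := sq_nonneg ‖(z - x) - t • v‖
      exact pow_eq_zero_iff (two_ne_zero) |>.1 (le_antisymm h3 this)
    rw [norm_eq_zero, sub_eq_zero, sub_eq_iff_eq_add'] at this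
    exact this
  rw [← h4]
  refine le_antisymm ?_ hzd
  have : infDist z M ≤ infDist x M + dist z x := infDist_le_infDist_add_dist
  rwa [dist_eq_norm, hzt] at this

/-- Federer's inequality: `M` stays outside the balls of radius `τ` tangent to it. -/
theorem UniqueNearest.inner_le {M : Set V} {τ : ℝ} (hM : IsClosed M)
    (hU : UniqueNearest M τ) {x p y : V} (hx : infDist x M < τ) (hp : p ∈ M)
    (hxp : dist x p = infDist x M) (hy : y ∈ M) :
    inner ℝ (x - p) (y - p) ≤ ‖x - p‖ * ‖y - p‖ ^ 2 / (2 * τ) := by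
  have hne : M.Nonempty := ⟨p, hp⟩
  have hδ0 : 0 ≤ infDist x M := infDist_nonneg
  rcases hδ0.eq_or_lt with h0 | h0
  · have : x - p = 0 := by rw [← h0, dist_eq_zero] at hxp; rw [hxp, sub_self]
    simp [this]
  set δ := infDist x M with hδ
  set v := δ⁻¹ • (x - p) with hv
  have hnp : ‖x - p‖ = δ := by rw [← dist_eq_norm]; exact hxp
  have hnv : ‖v‖ = 1 := by
    rw [hv, norm_smul, hnp, norm_inv, Real.norm_of_nonneg h0.le]
    field_simp
  have hxpv : x - p = δ • v := by rw [hv, smul_smul, mul_inv_cancel₀ h0.ne', one_smul]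
  have hτ : 0 < τ := hδ0.trans_lt hx
  have main : ∀ s, δ < s → s < τ → 2 * s * inner ℝ v (y - p) ≤ ‖y - p‖ ^ 2 := by
    intro s hs1 hs2
    have h1 := hU.infDist_ray hM hne h0 hp hxp (t := s - δ) (by linarith) (by linarith)
    have h2 : infDist (x + (s - δ) • v) M ≤ dist (x + (s - δ) • v) y :=
      infDist_le_dist_of_mem hy
    rw [h1, dist_eq_norm] at h2
    have e : x + (s - δ) • v - y = s • v - (y - p) := by
      have : x = p + δ • v := by rw [← hxpv]; abel
      rw [this, sub_smul]; abel
    rw [e, add_sub_cancel] at h2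
    have h3 : s ^ 2 ≤ ‖s • v - (y - p)‖ ^ 2 := by
      have : 0 ≤ s := by linarith
      gcongr
    rw [norm_sub_sq_real, norm_smul, hnv, real_inner_smul_left,
      Real.norm_of_nonneg (by linarith : 0 ≤ s)] at h3
    linarith
  have hfin : 2 * τ * inner ℝ v (y - p) ≤ ‖y - p‖ ^ 2 := by
    by_contra! h
    have hA : 0 < inner ℝ v (y - p) := by
      by_contra! hA
      nlinarith [sq_nonneg ‖y - p‖]
    have hlt : ‖y - p‖ ^ 2 / (2 * inner ℝ v (y - p)) < τ := by
      rw [div_lt_iff₀ (by linarith)]; linarith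
    obtain ⟨s, hs1, hs2⟩ := exists_between (max_lt hx hlt)
    obtain ⟨hs3, hs4⟩ := max_lt_iff.1 hs1
    have := main s hs3 hs2
    rw [div_lt_iff₀ (by linarith)] at hs4
    linarith
  rw [hnp, hxpv, real_inner_smul_left, le_div_iff₀ (by positivity)]
  nlinarith [mul_le_mul_of_nonneg_left hfin h0.le]

/-- The nearest-point map is Lipschitz near `M`. -/
theorem UniqueNearest.norm_nearest_sub_le {M : Set V} {τ ρ : ℝ} (hM : IsClosed M)
    (hU : UniqueNearest M τ) {x y p q : V} (hρ : ρ < τ) (hx : infDist x M ≤ ρ)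
    (hy : infDist y M ≤ ρ) (hp : p ∈ M) (hxp : dist x p = infDist x M) (hq : q ∈ M)
    (hyq : dist y q = infDist y M) :
    ‖p - q‖ * (1 - ρ / τ) ≤ ‖x - y‖ := by
  have hτ : 0 < τ := infDist_nonneg.trans_lt (hx.trans_lt hρ)
  have h1 := hU.inner_le hM (hx.trans_lt hρ) hp hxp hq
  have h2 := hU.inner_le hM (hy.trans_lt hρ) hq hyq hp
  rw [← dist_eq_norm x, hxp, norm_sub_rev q p] at h1
  rw [← dist_eq_norm y, hyq] at h2
  have h1' : inner ℝ (x - p) (q - p) ≤ ρ * ‖p - q‖ ^ 2 / (2 * τ) := h1.trans (by gcongr)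
  have h2' : inner ℝ (y - q) (p - q) ≤ ρ * ‖p - q‖ ^ 2 / (2 * τ) := h2.trans (by gcongr)
  have e : inner ℝ (x - p) (q - p) + inner ℝ (y - q) (p - q)
      = ‖p - q‖ ^ 2 - inner ℝ (x - y) (p - q) := by
    rw [← real_inner_self_eq_norm_sq, ← neg_sub p q, inner_neg_right, neg_add_eq_sub,
      ← inner_sub_left, ← inner_sub_left]
    congr 1
    abel
  have h3 : inner ℝ (x - y) (p - q) ≤ ‖x - y‖ * ‖p - q‖ := real_inner_le_norm _ _
  have h4 : ‖p - q‖ ^ 2 * (1 - ρ / τ) ≤ ‖x - y‖ * ‖p - q‖ := by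
    have : ρ * ‖p - q‖ ^ 2 / (2 * τ) + ρ * ‖p - q‖ ^ 2 / (2 * τ) = ‖p - q‖ ^ 2 * (ρ / τ) := by
      field_simp; ring
    linarith
  rcases (norm_nonneg (p - q)).eq_or_lt with h0 | h0
  · rw [← h0, zero_mul]; exact norm_nonneg _
  · refine le_of_mul_le_mul_right ?_ h0
    linarith

/-- A short chord of `M` stays quadratically close to `M`. -/
theorem UniqueNearest.infDist_segment_le {M : Set V} {T : ℝ} (hM : IsClosed M) (hT : 0 < T)
    (hU : UniqueNearest M (2 * T)) {u v : V} (hu : u ∈ M) (hv : v ∈ M) (huv : ‖u - v‖ ≤ T)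
    {t : ℝ} (ht0 : 0 ≤ t) (ht1 : t ≤ 1) :
    infDist ((1 - t) • u + t • v) M ≤ ‖u - v‖ ^ 2 / (14 * T) := by
  set m := (1 - t) • u + t • v with hm
  set δ := infDist m M with hδ
  have hδ0 : 0 ≤ δ := infDist_nonneg
  have emu : m - u = t • (v - u) := by rw [hm]; module
  have emv : m - v = (1 - t) • (u - v) := by rw [hm]; module
  have hmu : δ ≤ t * ‖u - v‖ := by
    have : δ ≤ dist m u := infDist_le_dist_of_mem hu
    rwa [dist_eq_norm, emu, norm_smul, Real.norm_of_nonneg ht0, norm_sub_rev] at this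
  have hmv : δ ≤ (1 - t) * ‖u - v‖ := by
    have : δ ≤ dist m v := infDist_le_dist_of_mem hv
    rwa [dist_eq_norm, emv, norm_smul, Real.norm_of_nonneg (by linarith)] at this
  have hδ2 : δ ≤ T / 2 := by linarith
  obtain ⟨p, hp, hmp⟩ := hM.exists_infDist_eq_dist ⟨u, hu⟩ m
  have hlt : infDist m M < 2 * T := by linarith
  have h1 := hU.inner_le hM hlt hp hmp.symm hu
  have h2 := hU.inner_le hM hlt hp hmp.symm hv
  rw [← dist_eq_norm m, ← hmp, ← hδ] at h1 h2
  have hnm : ‖m - p‖ = δ := by rw [← dist_eq_norm, ← hmp]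
  have e1 : (1 - t) * inner ℝ (m - p) (u - p) + t * inner ℝ (m - p) (v - p) = δ ^ 2 := by
    rw [← real_inner_smul_right, ← real_inner_smul_right, ← inner_add_right, ← hnm,
      ← real_inner_self_eq_norm_sq]
    congr 1
    rw [hm]; module
  have e2 : (1 - t) * ‖u - p‖ ^ 2 + t * ‖v - p‖ ^ 2 = δ ^ 2 + t * (1 - t) * ‖u - v‖ ^ 2 := by
    have a1 : u - p = (m - p) + t • (u - v) := by rw [hm]; module
    have a2 : v - p = (m - p) - (1 - t) • (u - v) := by rw [hm]; module
    rw [a1, a2, norm_add_sq_real, norm_sub_sq_real (m - p),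
      real_inner_smul_right, real_inner_smul_right,
      norm_smul, norm_smul, hnm, Real.norm_of_nonneg ht0,
      Real.norm_of_nonneg (by linarith : 0 ≤ 1 - t)]
    ring
  rcases hδ0.eq_or_lt with h0 | h0
  · rw [← h0]; positivity
  have h3 : δ ^ 2 ≤ δ * (δ ^ 2 + t * (1 - t) * ‖u - v‖ ^ 2) / (2 * (2 * T)) := by
    have i1 := mul_le_mul_of_nonneg_left h1 (by linarith : 0 ≤ 1 - t)
    have i2 := mul_le_mul_of_nonneg_left h2 ht0
    calc δ ^ 2 ≤ (1 - t) * (δ * ‖u - p‖ ^ 2 / (2 * (2 * T)))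
          + t * (δ * ‖v - p‖ ^ 2 / (2 * (2 * T))) := by linarith
      _ = δ * ((1 - t) * ‖u - p‖ ^ 2 + t * ‖v - p‖ ^ 2) / (2 * (2 * T)) := by ring
      _ = _ := by rw [e2]
  rw [le_div_iff₀ (by positivity)] at h3 ⊢
  have h4 : δ * (2 * (2 * T)) ≤ δ ^ 2 + t * (1 - t) * ‖u - v‖ ^ 2 := by
    refine le_of_mul_le_mul_left ?_ h0
    linarith
  have h5 : t * (1 - t) ≤ 1 / 4 := by nlinarith [sq_nonneg (t - 1 / 2)]
  have h6 := mul_le_mul_of_nonneg_right h5 (sq_nonneg ‖u - v‖)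
  nlinarith

end Reach

theorem ConformalGraph.uniqueNearest_of_le_reach {N : ℕ} {M : Set (EuclideanSpace ℝ (Fin N))}
    (hne : M.Nonempty) {τ : ℝ} (hτ : ENNReal.ofReal τ ≤ ConformalGraph.reach M) :
    UniqueNearest M τ := by
  intro x hx p hp q hq hxp hxq
  have hfin : Metric.infEDist x M ≠ ⊤ := Metric.infEDist_ne_top hne
  have h1 : Metric.infEDist x M < ConformalGraph.reach M := by
    refine lt_of_lt_of_le ?_ hτ
    rw [← ENNReal.ofReal_toReal hfin]
    exact (ENNReal.ofReal_lt_ofReal_iff (Metric.infDist_nonneg.trans_lt hx)).2 hx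
  obtain ⟨ρ, hρ, hxρ⟩ := lt_sSup_iff.1 h1
  have key : ∀ y, dist x y = Metric.infDist x M → edist x y = Metric.infEDist x M := by
    intro y hy
    rw [edist_dist, hy, Metric.infDist, ENNReal.ofReal_toReal hfin]
  exact (hρ x hxρ).unique ⟨hp, key p hxp⟩ ⟨hq, key q hxq⟩

/-! ### Weighted lengths of Lipschitz curves and of their chords -/

section Curves

open Set

variable {V : Type*} [NormedAddCommGroup V] [InnerProductSpace ℝ V] [FiniteDimensional ℝ V]

theorem LipschitzOnWith.ae_differentiableAt_Icc {γ : ℝ → V} {K : ℝ≥0} {a b : ℝ}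
    (h : LipschitzOnWith K γ (Icc a b)) :
    ∀ᵐ t ∂volume.restrict (Icc a b), DifferentiableAt ℝ γ t ∧ ‖deriv γ t‖ ≤ K := by
  rw [← restrict_Ioo_eq_restrict_Icc, ae_restrict_iff' measurableSet_Ioo]
  filter_upwards [h.ae_differentiableWithinAt_of_mem_real] with t ht hI
  have hn : Icc a b ∈ nhds t := Icc_mem_nhds hI.1 hI.2
  exact ⟨(ht (Ioo_subset_Icc_self hI)).differentiableAt hn, norm_deriv_le_of_lipschitzOn hn h⟩

theorem LipschitzOnWith.intervalIntegrable_mul_norm_deriv {γ : ℝ → V} {K : ℝ≥0} {a b : ℝ}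
    (hab : a ≤ b) (h : LipschitzOnWith K γ (Icc a b)) {g : ℝ → ℝ} (hg : ContinuousOn g (Icc a b)) :
    IntervalIntegrable (fun t => g t * ‖deriv γ t‖) volume a b := by
  rw [intervalIntegrable_iff_integrableOn_Icc_of_le hab]
  obtain ⟨C, hC⟩ := isCompact_Icc.exists_bound_of_continuousOn hg
  refine IntegrableOn.of_bound (by simp)
    ((hg.aestronglyMeasurable measurableSet_Icc).mul
      (stronglyMeasurable_deriv γ).norm.aestronglyMeasurable) (C * K) ?_
  filter_upwards [h.ae_differentiableAt_Icc, ae_restrict_mem measurableSet_Icc] with t ht hI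
  rw [norm_mul, norm_norm]
  exact mul_le_mul (hC t hI) ht.2 (norm_nonneg _) ((norm_nonneg _).trans (hC t hI))

theorem LipschitzOnWith.intervalIntegrable_norm_deriv {γ : ℝ → V} {K : ℝ≥0} {a b : ℝ}
    (hab : a ≤ b) (h : LipschitzOnWith K γ (Icc a b)) :
    IntervalIntegrable (fun t => ‖deriv γ t‖) volume a b := by
  simpa using h.intervalIntegrable_mul_norm_deriv hab (g := fun _ => 1) continuousOn_const

/-- The fundamental theorem of calculus for Lipschitz functions, as an inequality. -/
theorem LipschitzOnWith.sub_le_integral_of_deriv_le {F G : ℝ → ℝ} {K : ℝ≥0} {a b : ℝ}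
    (hab : a ≤ b) (hF : LipschitzOnWith K F (Icc a b)) (hG : IntervalIntegrable G volume a b)
    (h : ∀ᵐ t ∂volume.restrict (Icc a b), deriv F t ≤ G t) :
    F b - F a ≤ ∫ t in a..b, G t := by
  have hac : AbsolutelyContinuousOnInterval F a b := by
    apply LipschitzOnWith.absolutelyContinuousOnInterval
    rwa [uIcc_of_le hab]
  rw [← hac.integral_deriv_eq_sub]
  exact intervalIntegral.integral_mono_ae_restrict hab hac.intervalIntegrable_deriv hG h

theorem LipschitzOnWith.norm_sub_le_integral_norm_deriv {γ : ℝ → V} {K : ℝ≥0} {a b : ℝ}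
    (hab : a ≤ b) (h : LipschitzOnWith K γ (Icc a b)) :
    ‖γ b - γ a‖ ≤ ∫ t in a..b, ‖deriv γ t‖ := by
  set w := γ b - γ a with hw
  have hL : LipschitzOnWith (‖w‖₊ * K) (fun t => inner ℝ w (γ t)) (Icc a b) := by
    refine LipschitzOnWith.of_dist_le_mul fun s hs t ht => ?_
    rw [Real.dist_eq, ← inner_sub_right]
    refine (abs_real_inner_le_norm _ _).trans ?_
    have := h.dist_le_mul s hs t ht
    rw [dist_eq_norm] at this
    push_cast
    rw [mul_assoc]
    exact mul_le_mul_of_nonneg_left this (norm_nonneg _)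
  have h1 := hL.sub_le_integral_of_deriv_le hab
    ((h.intervalIntegrable_norm_deriv hab).const_mul ‖w‖) (by
      filter_upwards [h.ae_differentiableAt_Icc] with t ht
      have hd : HasDerivAt (fun t => inner ℝ w (γ t)) (inner ℝ w (deriv γ t)) t := by
        simpa using (hasDerivAt_const t w).inner ℝ ht.1.hasDerivAt
      rw [hd.deriv]
      exact real_inner_le_norm _ _)
  simp only [← inner_sub_right] at h1
  rw [intervalIntegral.integral_const_mul, ← hw, real_inner_self_eq_norm_sq, sq] at h1
  rcases (norm_nonneg w).eq_or_lt with h0 | h0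
  · rw [← h0]
    exact intervalIntegral.integral_nonneg hab fun _ _ => norm_nonneg _
  · exact le_of_mul_le_mul_left h1 h0

/-- A point whose distances to `u` and `v` add up to at most `L` lies in an ellipsoid with foci `u`
and `v`: its distance to the line through `u` and `v` is at most the minor semi-axis. -/
theorem four_mul_norm_sub_lineMap_sq_le {V : Type*} [NormedAddCommGroup V]
    [InnerProductSpace ℝ V] {u v z : V} {L : ℝ} (huv : u ≠ v)
    (hL : ‖z - u‖ + ‖v - z‖ ≤ L) :
    4 * ‖z - ((1 - inner ℝ (z - u) (v - u) / ‖v - u‖ ^ 2) • u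
      + (inner ℝ (z - u) (v - u) / ‖v - u‖ ^ 2) • v)‖ ^ 2 ≤ L ^ 2 - ‖v - u‖ ^ 2 := by
  set d := v - u with hd
  have hd0 : 0 < ‖d‖ := norm_pos_iff.2 (sub_ne_zero.2 huv.symm)
  set σ := inner ℝ (z - u) d / ‖d‖ ^ 2 with hσ
  set y := z - ((1 - σ) • u + σ • v) with hy
  have hyd : inner ℝ y d = 0 := by
    have : y = (z - u) - σ • d := by rw [hy, hd]; module
    rw [this, inner_sub_left, real_inner_smul_left, real_inner_self_eq_norm_sq, hσ]
    field_simp; ring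
  have e1 : z - u = y + σ • d := by rw [hy, hd]; module
  have e2 : v - z = (1 - σ) • d - y := by rw [hy, hd]; module
  have n1 : ‖z - u‖ ^ 2 = ‖y‖ ^ 2 + (σ * ‖d‖) ^ 2 := by
    rw [e1, norm_add_sq_real, real_inner_smul_right, hyd, norm_smul, mul_pow, Real.norm_eq_abs,
      sq_abs]
    ring
  have n2 : ‖v - z‖ ^ 2 = ‖y‖ ^ 2 + ((1 - σ) * ‖d‖) ^ 2 := by
    rw [e2, norm_sub_sq_real, real_inner_smul_left, real_inner_comm, hyd, norm_smul, mul_pow,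
      Real.norm_eq_abs, sq_abs]
    ring
  have h3 : ‖y‖ ^ 2 + (σ * ‖d‖) * ((1 - σ) * ‖d‖) ≤ ‖z - u‖ * ‖v - z‖ := by
    refine le_of_sq_le_sq ?_ (by positivity)
    rw [mul_pow, n1, n2]
    nlinarith [mul_nonneg (sq_nonneg ‖y‖) (sq_nonneg (σ * ‖d‖ - (1 - σ) * ‖d‖))]
  have h4 : (‖z - u‖ + ‖v - z‖) ^ 2 ≤ L ^ 2 := by gcongr
  nlinarith

/-- Comparison of the weighted length of a curve with the weighted length of its chord. A curve of
length `L` stays within distance `H = √(L² - ℓ²) / 2` of the line through its end points; projecting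
it orthogonally to this line costs at most `κ H ℓ` for the part of the weight above `fmin`, and the
part `fmin` of the weight charges the excess length `L - ℓ`. -/
theorem LipschitzOnWith.chord_integral_le {f : V → ℝ} {κ : ℝ≥0} (hf : LipschitzWith κ f) {fmin : ℝ}
    (hfmin : ∀ x, fmin ≤ f x) {γ : ℝ → V} {K : ℝ≥0} {a b : ℝ} (hab : a ≤ b)
    (hγ : LipschitzOnWith K γ (Icc a b)) (hne : γ a ≠ γ b) {L H : ℝ}
    (hL : L = ∫ t in a..b, ‖deriv γ t‖) (hH0 : 0 ≤ H) (hH : L ^ 2 - ‖γ b - γ a‖ ^ 2 ≤ 4 * H ^ 2) :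
    ‖γ b - γ a‖ * ∫ t in (0 : ℝ)..1, f ((1 - t) • γ a + t • γ b)
      ≤ (∫ t in a..b, f (γ t) * ‖deriv γ t‖) - fmin * (L - ‖γ b - γ a‖)
        + κ * H * ‖γ b - γ a‖ := by
  set d := γ b - γ a with hd
  have hd0 : 0 < ‖d‖ := norm_pos_iff.2 (sub_ne_zero.2 hne.symm)
  set seg : ℝ → V := fun t => (1 - t) • γ a + t • γ b with hseg
  have hsegc : Continuous seg := by fun_prop
  set s : ℝ → ℝ := fun t => inner ℝ (γ t - γ a) d / ‖d‖ ^ 2 with hs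
  set ψ : ℝ → ℝ := fun σ => max (f (seg σ) - κ * H - fmin) 0 with hψ
  have hψc : Continuous ψ := ((hf.continuous.comp hsegc).sub continuous_const |>.sub
    continuous_const).max continuous_const
  have hψ0 : ∀ σ, 0 ≤ ψ σ := fun σ => le_max_right _ _
  have hI : IntervalIntegrable (fun t => f (γ t) * ‖deriv γ t‖) volume a b :=
    hγ.intervalIntegrable_mul_norm_deriv hab (hf.continuous.comp_continuousOn hγ.continuousOn)
  have hI' := hγ.intervalIntegrable_norm_deriv hab
  -- the orthogonal projection keeps the curve within distance `H`
  have hdist : ∀ t ∈ Icc a b, ‖γ t - seg (s t)‖ ≤ H := by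
    intro t ht
    have h1 : ‖γ t - γ a‖ ≤ ∫ t in a..t, ‖deriv γ t‖ :=
      (hγ.mono (Icc_subset_Icc_right ht.2)).norm_sub_le_integral_norm_deriv ht.1
    have h2 : ‖γ b - γ t‖ ≤ ∫ t in t..b, ‖deriv γ t‖ :=
      (hγ.mono (Icc_subset_Icc_left ht.1)).norm_sub_le_integral_norm_deriv ht.2
    have h3 : (∫ t in a..t, ‖deriv γ t‖) + (∫ t in t..b, ‖deriv γ t‖) = L := by
      rw [hL]
      refine intervalIntegral.integral_add_adjacent_intervals ?_ ?_
      · exact (hγ.mono (Icc_subset_Icc_right ht.2)).intervalIntegrable_norm_deriv ht.1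
      · exact (hγ.mono (Icc_subset_Icc_left ht.1)).intervalIntegrable_norm_deriv ht.2
    have h4 := four_mul_norm_sub_lineMap_sq_le (L := L) hne (show _ + _ ≤ L by linarith)
    have h5 : ‖γ t - seg (s t)‖ ^ 2 ≤ H ^ 2 := by
      have := h4.trans hH
      linarith
    exact le_of_sq_le_sq h5 hH0
  -- `s` and the primitive `Ψ` of `ψ` are Lipschitz on the relevant sets
  have hsL : LipschitzOnWith (K / ‖d‖₊) s (Icc a b) := by
    refine LipschitzOnWith.of_dist_le_mul fun x hx y hy => ?_
    have e : s x - s y = inner ℝ (γ x - γ y) d / ‖d‖ ^ 2 := by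
      rw [hs]
      simp only
      rw [← sub_div, ← inner_sub_left]
      congr 2
      abel
    rw [Real.dist_eq, e, abs_div, abs_of_nonneg (sq_nonneg ‖d‖), div_le_iff₀ (by positivity)]
    refine (abs_real_inner_le_norm _ _).trans ?_
    have := hγ.dist_le_mul x hx y hy
    rw [dist_eq_norm] at this
    calc ‖γ x - γ y‖ * ‖d‖ ≤ (K * dist x y) * ‖d‖ := by gcongr
      _ = _ := by push_cast; field_simp
  set Ψ : ℝ → ℝ := fun σ => ∫ τ in (0 : ℝ)..σ, ψ τ with hΨ
  have hΨd : ∀ σ, HasDerivAt Ψ (ψ σ) σ := fun σ =>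
    intervalIntegral.integral_hasDerivAt_right (hψc.intervalIntegrable _ _)
      (hψc.stronglyMeasurableAtFilter _ _) hψc.continuousAt
  obtain ⟨K', hK'⟩ : ∃ K' : ℝ≥0, LipschitzOnWith K' (Ψ ∘ s) (Icc a b) := by
    have hcpt : IsCompact (s '' Icc a b) := isCompact_Icc.image_of_continuousOn hsL.continuousOn
    obtain ⟨R, hR⟩ := hcpt.isBounded.subset_closedBall 0
    obtain ⟨C, hC⟩ := (isCompact_closedBall (0 : ℝ) R).exists_bound_of_continuousOn
      hψc.continuousOn
    have hΨL : LipschitzOnWith C.toNNReal Ψ (Metric.closedBall 0 R) := by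
      refine (convex_closedBall _ _).lipschitzOnWith_of_nnnorm_hasDerivWithin_le
        (fun x _ => (hΨd x).hasDerivWithinAt) fun x hx => ?_
      rw [← norm_toNNReal]
      exact Real.toNNReal_le_toNNReal (hC x hx)
    exact ⟨_, hΨL.comp hsL fun t ht => hR (mem_image_of_mem s ht)⟩
  have hG : IntervalIntegrable
      (fun t => (f (γ t) * ‖deriv γ t‖ - fmin * ‖deriv γ t‖) / ‖d‖) volume a b :=
    (hI.sub (hI'.const_mul fmin)).div_const _
  have h1 := hK'.sub_le_integral_of_deriv_le hab hG (by
    filter_upwards [hγ.ae_differentiableAt_Icc, ae_restrict_mem measurableSet_Icc] with t ht htI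
    have hsd : HasDerivAt s (inner ℝ (deriv γ t) d / ‖d‖ ^ 2) t := by
      have h := (ht.1.hasDerivAt.sub_const (γ a)).inner ℝ (hasDerivAt_const t d)
      simp only [inner_zero_right, zero_add] at h
      exact h.div_const _
    rw [((hΨd (s t)).comp t hsd).deriv, mul_div_assoc', div_le_div_iff₀ (by positivity) hd0]
    have i1 : inner ℝ (deriv γ t) d ≤ ‖deriv γ t‖ * ‖d‖ := real_inner_le_norm _ _
    have i2 : ψ (s t) ≤ f (γ t) - fmin := by
      refine max_le ?_ (by linarith [hfmin (γ t)])
      have h := hf.dist_le_mul (seg (s t)) (γ t)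
      rw [Real.dist_eq, dist_eq_norm, norm_sub_rev] at h
      have := (le_abs_self _).trans (h.trans (mul_le_mul_of_nonneg_left (hdist t htI) κ.coe_nonneg))
      linarith
    calc ψ (s t) * inner ℝ (deriv γ t) d * ‖d‖
        ≤ ψ (s t) * (‖deriv γ t‖ * ‖d‖) * ‖d‖ := by
          gcongr
      _ ≤ (f (γ t) - fmin) * (‖deriv γ t‖ * ‖d‖) * ‖d‖ := by gcongr
      _ = _ := by ring)
  have hsa : s a = 0 := by simp [hs]
  have hsb : s b = 1 := by
    rw [hs]
    simp only
    rw [← hd, real_inner_self_eq_norm_sq, div_self (by positivity)]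
  rw [intervalIntegral.integral_div, intervalIntegral.integral_sub hI (hI'.const_mul fmin),
    intervalIntegral.integral_const_mul, ← hL, Function.comp, Function.comp, hsa, hsb, hΨ] at h1
  simp only [intervalIntegral.integral_same, sub_zero] at h1
  rw [le_div_iff₀ hd0] at h1
  have h2 : (∫ t in (0 : ℝ)..1, f (seg t)) - κ * H - fmin ≤ ∫ t in (0 : ℝ)..1, ψ t := by
    have hi : IntervalIntegrable (fun t => f (seg t)) volume 0 1 :=
      (hf.continuous.comp hsegc).intervalIntegrable _ _
    have e : (∫ t in (0 : ℝ)..1, f (seg t)) - κ * H - fmin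
        = ∫ t in (0 : ℝ)..1, (f (seg t) - κ * H - fmin) := by
      rw [intervalIntegral.integral_sub (hi.sub intervalIntegrable_const)
        intervalIntegrable_const, intervalIntegral.integral_sub hi intervalIntegrable_const]
      simp
    rw [e]
    exact intervalIntegral.integral_mono_on zero_le_one
      ((hi.sub intervalIntegrable_const).sub intervalIntegrable_const)
      (hψc.intervalIntegrable _ _) fun t _ => le_max_left _ _
  nlinarith [mul_le_mul_of_nonneg_right h2 hd0.le]

/-- The chord bound in quantitative form: the gain `κ H ℓ` is at most the loss `fmin (L - ℓ)` plus
a term cubic in `ℓ`. -/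
theorem LipschitzOnWith.chord_integral_le_mul {f : V → ℝ} {κ : ℝ≥0} (hf : LipschitzWith κ f)
    {fmin T : ℝ} (hfmin0 : 0 < fmin) (hfmin : ∀ x, fmin ≤ f x) (hT : 0 < T)
    (hκ : 8 * κ * T ≤ fmin) {γ : ℝ → V} {K : ℝ≥0} {a b : ℝ} (hab : a ≤ b)
    (hγ : LipschitzOnWith K γ (Icc a b)) (hl : ‖γ b - γ a‖ ≤ T) :
    ‖γ b - γ a‖ * ∫ t in (0 : ℝ)..1, f ((1 - t) • γ a + t • γ b)
      ≤ (1 + ‖γ b - γ a‖ ^ 2 / (256 * T ^ 2)) * ∫ t in a..b, f (γ t) * ‖deriv γ t‖ := by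
  set Λ := ∫ t in a..b, f (γ t) * ‖deriv γ t‖ with hΛ
  have hΛ0 : 0 ≤ Λ := intervalIntegral.integral_nonneg hab fun t _ =>
    mul_nonneg (hfmin0.le.trans (hfmin _)) (norm_nonneg _)
  rcases eq_or_ne (γ a) (γ b) with he | hne
  · simpa [he] using hΛ0
  set ℓ := ‖γ b - γ a‖ with hℓ
  have hℓ0 : 0 < ℓ := norm_pos_iff.2 (sub_ne_zero.2 hne.symm)
  set L := ∫ t in a..b, ‖deriv γ t‖ with hL
  have hℓL : ℓ ≤ L := hγ.norm_sub_le_integral_norm_deriv hab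
  have hLΛ : fmin * L ≤ Λ := by
    rw [hL, ← intervalIntegral.integral_const_mul]
    refine intervalIntegral.integral_mono_on hab
      ((hγ.intervalIntegrable_norm_deriv hab).const_mul _)
      (hγ.intervalIntegrable_mul_norm_deriv hab
        (hf.continuous.comp_continuousOn hγ.continuousOn)) fun t _ => ?_
    exact mul_le_mul_of_nonneg_right (hfmin _) (norm_nonneg _)
  have hsq : 0 ≤ L ^ 2 - ℓ ^ 2 := by nlinarith
  obtain ⟨H, hH0, hHsq⟩ : ∃ H : ℝ, 0 ≤ H ∧ 4 * H ^ 2 = L ^ 2 - ℓ ^ 2 :=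
    ⟨√(L ^ 2 - ℓ ^ 2) / 2, by positivity, by rw [div_pow, Real.sq_sqrt hsq]; ring⟩
  have h1 := hγ.chord_integral_le hf hfmin hab hne hL hH0 hHsq.ge
  have h2 : ℓ * H / (8 * T) ≤ (L - ℓ) + ℓ ^ 3 / (256 * T ^ 2) := by
    refine le_of_sq_le_sq ?_ (by have := sub_nonneg.2 hℓL; positivity)
    have hx : ℓ ^ 2 / T ^ 2 ≤ 1 := by
      rw [div_le_one (by positivity)]; gcongr
    have e1 : (ℓ * H / (8 * T)) ^ 2 = ℓ ^ 2 / T ^ 2 * (L ^ 2 - ℓ ^ 2) / 256 := by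
      rw [← hHsq]; field_simp; ring
    have e2 : ℓ ^ 3 / (256 * T ^ 2) = ℓ * (ℓ ^ 2 / T ^ 2) / 256 := by field_simp
    rw [e1, e2]
    have hx0 : 0 ≤ ℓ ^ 2 / T ^ 2 := by positivity
    generalize ℓ ^ 2 / T ^ 2 = x at *
    have e3 : L ^ 2 - ℓ ^ 2 = (L - ℓ) * ((L - ℓ) + 2 * ℓ) := by ring
    have hD : 0 ≤ L - ℓ := sub_nonneg.2 hℓL
    rw [e3]
    generalize L - ℓ = D at *
    nlinarith [mul_nonneg (sub_nonneg.2 hx) (sq_nonneg D), sq_nonneg (ℓ * x), sq_nonneg D]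
  have h3 : κ * H * ℓ ≤ fmin * (ℓ * H / (8 * T)) := by
    rw [mul_div_assoc', le_div_iff₀ (by positivity)]
    nlinarith [mul_le_mul_of_nonneg_right hκ (mul_nonneg hℓ0.le hH0)]
  have h4 : fmin * (ℓ ^ 3 / (256 * T ^ 2)) ≤ ℓ ^ 2 / (256 * T ^ 2) * Λ := by
    have : fmin * ℓ ≤ Λ := (mul_le_mul_of_nonneg_left hℓL hfmin0.le).trans hLΛ
    calc fmin * (ℓ ^ 3 / (256 * T ^ 2)) = ℓ ^ 2 / (256 * T ^ 2) * (fmin * ℓ) := by ring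
      _ ≤ _ := by gcongr
  nlinarith [mul_le_mul_of_nonneg_left h2 hfmin0.le]

end Curves

/-! ### The conformal distance -/

namespace ConformalGraph

open Set

section Length

variable {N : ℕ} {M : Set (EuclideanSpace ℝ (Fin N))} {f : EuclideanSpace ℝ (Fin N) → ℝ}
  {x y z : EuclideanSpace ℝ (Fin N)} {a b c e : ℝ} {γ γ' : ℝ → EuclideanSpace ℝ (Fin N)}

theorem conformalLength_congr (h : EqOn γ γ' (Ioo a b)) :
    conformalLength f a b γ = conformalLength f a b γ' := by
  rw [conformalLength, conformalLength, ← restrict_Ioo_eq_restrict_Icc]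
  refine setLIntegral_congr_fun measurableSet_Ioo fun t ht => ?_
  have he : γ =ᶠ[nhds t] γ' := h.eventuallyEq_of_mem (Ioo_mem_nhds ht.1 ht.2)
  simp only [he.deriv_eq, h ht]

theorem conformalLength_comp_sub_const (s : ℝ) :
    conformalLength f (a + s) (b + s) (fun t => γ (t - s)) = conformalLength f a b γ := by
  have h := (measurePreserving_sub_right volume s).setLIntegral_comp_preimage_emb
    (MeasurableEquiv.subRight s).measurableEmbedding
    (fun t => ENNReal.ofReal (f (γ t) * ‖deriv γ t‖)) (Icc a b)
  rw [preimage_sub_const_Icc] at h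
  rw [conformalLength, conformalLength, ← h]
  simp only [deriv_comp_sub_const]

theorem conformalLength_add (hab : a ≤ b) (hbc : b ≤ c) :
    conformalLength f a b γ + conformalLength f b c γ = conformalLength f a c γ := by
  simp only [conformalLength, ← restrict_Ioc_eq_restrict_Icc]
  rw [← Ioc_union_Ioc_eq_Ioc hab hbc,
    lintegral_union measurableSet_Ioc (Ioc_disjoint_Ioc_of_le le_rfl)]

theorem IsLipschitzPath.conformalLength_eq (h : IsLipschitzPath M x y a b γ) (hf : Continuous f)
    (hf0 : ∀ x, 0 ≤ f x) :
    conformalLength f a b γ = ENNReal.ofReal (∫ t in a..b, f (γ t) * ‖deriv γ t‖) := by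
  obtain ⟨K, hK⟩ := h.lipschitz
  have hi : IntervalIntegrable (fun t => f (γ t) * ‖deriv γ t‖) volume a b :=
    hK.intervalIntegrable_mul_norm_deriv h.lt.le (hf.comp_continuousOn hK.continuousOn)
  rw [intervalIntegral.integral_of_le h.lt.le, ← integral_Icc_eq_integral_Ioc,
    ofReal_integral_eq_lintegral_ofReal
      ((intervalIntegrable_iff_integrableOn_Icc_of_le h.lt.le).1 hi)
      (Filter.Eventually.of_forall fun t => mul_nonneg (hf0 _) (norm_nonneg _)), conformalLength]

theorem IsLipschitzPath.conformalDist_le (h : IsLipschitzPath M x y a b γ) :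
    conformalDist M f x y ≤ conformalLength f a b γ :=
  iInf_le_of_le a <| iInf_le_of_le b <| iInf_le_of_le γ <| iInf_le _ h

theorem exists_isLipschitzPath_lt {D : ℝ≥0∞} (h : conformalDist M f x y < D) :
    ∃ a b γ, IsLipschitzPath M x y a b γ ∧ conformalLength f a b γ < D := by
  simp only [conformalDist, iInf_lt_iff] at h
  obtain ⟨a, b, γ, h1, h2⟩ := h
  exact ⟨a, b, γ, h1, h2⟩

/-- Concatenation of paths. -/
theorem IsLipschitzPath.conformalDist_le_add (h : IsLipschitzPath M x y a b γ)
    (h' : IsLipschitzPath M y z c e γ') :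
    conformalDist M f x z ≤ conformalLength f a b γ + conformalLength f c e γ' := by
  obtain ⟨K, hK⟩ := h.lipschitz
  obtain ⟨K', hK'⟩ := h'.lipschitz
  have hlt := h.lt
  have hlt' := h'.lt
  set δ : ℝ → EuclideanSpace ℝ (Fin N) := fun t => if t ≤ b then γ t else γ' (t - (b - c)) with hδ
  have hδ1 : ∀ t, t ≤ b → δ t = γ t := fun t ht => if_pos ht
  have hδ2 : ∀ t, b ≤ t → δ t = γ' (t - (b - c)) := by
    intro t ht
    rcases ht.eq_or_lt with rfl | ht
    · rw [hδ1 b le_rfl, sub_sub_cancel, h.target, h'.source]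
    · exact if_neg ht.not_ge
  have hL1 : LipschitzOnWith (max K K') δ (Icc a b) := by
    refine LipschitzOnWith.of_dist_le_mul fun s hs t ht => ?_
    rw [hδ1 s hs.2, hδ1 t ht.2]
    refine (hK.dist_le_mul s hs t ht).trans ?_
    gcongr
    exact_mod_cast le_max_left K K'
  have hL2 : LipschitzOnWith (max K K') δ (Icc b (e + (b - c))) := by
    refine LipschitzOnWith.of_dist_le_mul fun s hs t ht => ?_
    rw [hδ2 s hs.1, hδ2 t ht.1]
    refine (hK'.dist_le_mul _ ⟨by linarith [hs.1], by linarith [hs.2]⟩ _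
      ⟨by linarith [ht.1], by linarith [ht.2]⟩).trans ?_
    rw [dist_sub_right]
    gcongr
    exact_mod_cast le_max_right K K'
  have key : ∀ s t, s ∈ Icc a b → t ∈ Icc b (e + (b - c)) →
      dist (δ s) (δ t) ≤ (max K K' : ℝ≥0) * dist s t := by
    intro s t hs ht
    refine (dist_triangle _ (δ b) _).trans ?_
    have h1 := hL1.dist_le_mul s hs b (right_mem_Icc.2 hlt.le)
    have h2 := hL2.dist_le_mul b (left_mem_Icc.2 (by linarith)) t ht
    have h3 : dist s b + dist b t = dist s t := by
      rw [Real.dist_eq, Real.dist_eq, Real.dist_eq, abs_of_nonpos (by linarith [hs.2]),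
        abs_of_nonpos (by linarith [ht.1]), abs_of_nonpos (by linarith [hs.2, ht.1])]
      ring
    rw [← h3, mul_add]
    exact add_le_add h1 h2
  have hpath : IsLipschitzPath M x z a (e + (b - c)) δ := by
    refine ⟨by linarith, ⟨max K K', LipschitzOnWith.of_dist_le_mul fun s hs t ht => ?_⟩, ?_, ?_, ?_⟩
    · rcases le_total s b with h1 | h1 <;> rcases le_total t b with h2 | h2
      · exact hL1.dist_le_mul s ⟨hs.1, h1⟩ t ⟨ht.1, h2⟩
      · exact key s t ⟨hs.1, h1⟩ ⟨h2, ht.2⟩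
      · rw [dist_comm, dist_comm s]
        exact key t s ⟨ht.1, h2⟩ ⟨h1, hs.2⟩
      · exact hL2.dist_le_mul s ⟨h1, hs.2⟩ t ⟨h2, ht.2⟩
    · intro t ht
      rcases le_total t b with h1 | h1
      · rw [hδ1 t h1]; exact h.mapsTo ⟨ht.1, h1⟩
      · rw [hδ2 t h1]; exact h'.mapsTo ⟨by linarith, by linarith [ht.2]⟩
    · rw [hδ1 a hlt.le, h.source]
    · rw [hδ2 _ (by linarith), add_sub_cancel_right, h'.target]
  refine hpath.conformalDist_le.trans_eq ?_
  rw [← conformalLength_add hlt.le (by linarith : b ≤ e + (b - c)),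
    conformalLength_congr (γ' := γ) (fun t ht => hδ1 t ht.2.le),
    conformalLength_congr (γ' := fun t => γ' (t - (b - c))) (fun t ht => hδ2 t ht.1.le),
    ← conformalLength_comp_sub_const (a := c) (b := e) (γ := γ') (b - c), add_sub_cancel]

theorem conformalDist_triangle (x y z : EuclideanSpace ℝ (Fin N)) :
    conformalDist M f x z ≤ conformalDist M f x y + conformalDist M f y z := by
  refine ENNReal.le_of_forall_pos_le_add fun ε hε hfin => ?_
  have hx : conformalDist M f x y ≠ ⊤ := fun h => by simp [h] at hfin
  have hy : conformalDist M f y z ≠ ⊤ := fun h => by simp [h] at hfin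
  have hε2 : ((ε : ℝ≥0∞) / 2) ≠ 0 := by simp [hε.ne']
  obtain ⟨a, b, γ, h1, h2⟩ := exists_isLipschitzPath_lt (ENNReal.lt_add_right hx hε2)
  obtain ⟨c, e, γ', h1', h2'⟩ := exists_isLipschitzPath_lt (ENNReal.lt_add_right hy hε2)
  calc conformalDist M f x z ≤ _ := h1.conformalDist_le_add h1'
    _ ≤ (conformalDist M f x y + ε / 2) + (conformalDist M f y z + ε / 2) := add_le_add h2.le h2'.le
    _ = _ := by rw [add_add_add_comm, ENNReal.add_halves]

theorem IsLipschitzPath.conformalDist_add_le (h : IsLipschitzPath M x y a b γ) {t : ℝ}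
    (hat : a < t) (htb : t < b) :
    conformalDist M f x (γ t) + conformalDist M f (γ t) y ≤ conformalLength f a b γ := by
  obtain ⟨K, hK⟩ := h.lipschitz
  rw [← conformalLength_add hat.le htb.le]
  have s1 : Icc a t ⊆ Icc a b := Icc_subset_Icc_right htb.le
  have s2 : Icc t b ⊆ Icc a b := Icc_subset_Icc_left hat.le
  exact add_le_add
    (conformalDist_le ⟨hat, ⟨K, hK.mono s1⟩, h.mapsTo.mono_left s1, h.source, rfl⟩)
    (conformalDist_le ⟨htb, ⟨K, hK.mono s2⟩, h.mapsTo.mono_left s2, rfl, h.target⟩)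

end Length

/-- The assumptions on the domain `M` and the conformal factor `f` at a finite scale `T`: the reach
of `M` is at least `2 * T`, in the form `UniqueNearest M (2 * T)`, and the relative variation of `f`
is controlled by `8 * κ * T ≤ fmin`. -/
structure AdmissibleScale {N : ℕ} (M : Set (EuclideanSpace ℝ (Fin N)))
    (f : EuclideanSpace ℝ (Fin N) → ℝ) (κ : ℝ≥0) (fmin T : ℝ) : Prop where
  closed : IsClosed M
  conn : IsPathConnected M
  pos : 0 < T
  nearest : UniqueNearest M (2 * T)
  lip : LipschitzWith κ f
  fmin_pos : 0 < fmin
  fmin_le : ∀ x, fmin ≤ f x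
  le_fmin : 8 * κ * T ≤ fmin

namespace AdmissibleScale

variable {N : ℕ} {M : Set (EuclideanSpace ℝ (Fin N))} {f : EuclideanSpace ℝ (Fin N) → ℝ}
  {κ : ℝ≥0} {fmin T : ℝ} {u v w : EuclideanSpace ℝ (Fin N)}

theorem f_pos (h : AdmissibleScale M f κ fmin T) (x : EuclideanSpace ℝ (Fin N)) : 0 < f x :=
  h.fmin_pos.trans_le (h.fmin_le x)

theorem continuous_segment (h : AdmissibleScale M f κ fmin T) :
    Continuous fun t : ℝ => f ((1 - t) • u + t • v) :=
  h.lip.continuous.comp (by fun_prop)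

theorem fmin_le_segment_integral (h : AdmissibleScale M f κ fmin T) :
    fmin ≤ ∫ t in (0 : ℝ)..1, f ((1 - t) • u + t • v) := by
  have := intervalIntegral.integral_mono_on zero_le_one
    (intervalIntegrable_const (c := fmin) (μ := volume))
    (h.continuous_segment (u := u) (v := v) |>.intervalIntegrable 0 1) fun t _ => h.fmin_le _
  simpa using this

/-- A short chord of `M`, projected to `M`, is a Lipschitz path in `M` whose conformal length
exceeds the weight of the chord by a relative error of second order. -/
theorem conformalDist_le (h : AdmissibleScale M f κ fmin T) (hu : u ∈ M) (hv : v ∈ M)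
    (huv : ‖u - v‖ ≤ T) :
    conformalDist M f u v
      ≤ ENNReal.ofReal ((1 + ‖u - v‖ ^ 2 / (20 * T ^ 2)) * weight f ⊤ u v) := by
  have hT := h.pos
  set ℓ := ‖u - v‖ with hℓ
  have hℓ0 : 0 ≤ ℓ := norm_nonneg _
  choose π hπM hπ using h.closed.exists_infDist_eq_dist ⟨u, hu⟩
  set seg : ℝ → EuclideanSpace ℝ (Fin N) := fun t => (1 - t) • u + t • v with hseg
  set ρ := ℓ ^ 2 / (14 * T) with hρ
  have hsegρ : ∀ t ∈ Icc (0 : ℝ) 1, Metric.infDist (seg t) M ≤ ρ := fun t ht =>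
    h.nearest.infDist_segment_le h.closed hT hu hv huv ht.1 ht.2
  set X := ℓ ^ 2 / T ^ 2 with hX
  have hX0 : 0 ≤ X := by positivity
  have hX1 : X ≤ 1 := by
    rw [hX, div_le_one (by positivity)]; gcongr
  have hρT : ρ / (2 * T) = X / 28 := by rw [hρ, hX]; field_simp; ring
  have hρlt : ρ < 2 * T := by
    rw [← div_lt_one (by positivity), hρT]; linarith
  have hden : 0 < 1 - X / 28 := by linarith
  set C := ℓ / (1 - X / 28) with hC
  have hC0 : 0 ≤ C := by positivity
  have hLip : LipschitzOnWith C.toNNReal (fun t => π (seg t)) (Icc 0 1) := by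
    refine LipschitzOnWith.of_dist_le_mul fun s hs t ht => ?_
    have h1 := h.nearest.norm_nearest_sub_le h.closed hρlt (hsegρ s hs) (hsegρ t ht) (hπM _)
      (hπ _).symm (hπM _) (hπ _).symm
    have h2 : seg s - seg t = (t - s) • (u - v) := by rw [hseg]; module
    rw [hρT, h2, norm_smul, ← hℓ] at h1
    rw [Real.coe_toNNReal _ hC0, dist_eq_norm, hC, div_mul_eq_mul_div, le_div_iff₀ hden,
      Real.dist_eq, abs_sub_comm]
    rw [Real.norm_eq_abs] at h1
    linarith
  have hπid : ∀ w ∈ M, π w = w := by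
    intro w hw
    have := hπ w
    rw [Metric.infDist_zero_of_mem hw] at this
    exact (dist_eq_zero.1 this.symm).symm
  have hpath : IsLipschitzPath M u v 0 1 (fun t => π (seg t)) := by
    refine ⟨zero_lt_one, ⟨_, hLip⟩, fun t _ => hπM _, ?_, ?_⟩
    · simp [hseg, hπid u hu]
    · simp [hseg, hπid v hv]
  refine hpath.conformalDist_le.trans ?_
  rw [hpath.conformalLength_eq h.lip.continuous fun x => (h.f_pos x).le]
  refine ENNReal.ofReal_le_ofReal ?_
  have hc := h.continuous_segment (u := u) (v := v)
  have h1 : ∫ t in (0 : ℝ)..1, f (π (seg t)) * ‖deriv (fun t => π (seg t)) t‖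
      ≤ ∫ t in (0 : ℝ)..1, (f (seg t) + κ * ρ) * C := by
    refine intervalIntegral.integral_mono_ae_restrict zero_le_one
      (hLip.intervalIntegrable_mul_norm_deriv zero_le_one
        (h.lip.continuous.comp_continuousOn hLip.continuousOn))
      (((hc.add continuous_const).mul continuous_const).intervalIntegrable _ _) ?_
    filter_upwards [hLip.ae_differentiableAt_Icc, ae_restrict_mem measurableSet_Icc] with t ht htI
    have h2 := ht.2
    rw [Real.coe_toNNReal _ hC0] at h2
    have h3 : f (π (seg t)) ≤ f (seg t) + κ * ρ := by
      have h4 := (le_abs_self _).trans (h.lip.dist_le_mul (π (seg t)) (seg t))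
      rw [dist_comm, ← hπ] at h4
      have := mul_le_mul_of_nonneg_left (hsegρ t htI) κ.coe_nonneg
      linarith
    exact mul_le_mul h3 h2 (norm_nonneg _) ((h.f_pos _).le.trans h3)
  refine h1.trans ?_
  rw [intervalIntegral.integral_mul_const, intervalIntegral.integral_add
    (hc.intervalIntegrable _ _) intervalIntegrable_const]
  simp only [intervalIntegral.integral_const, sub_zero, one_smul]
  have hwt : weight f ⊤ u v = ℓ * ∫ t in (0 : ℝ)..1, f (seg t) := rfl
  have hF := h.fmin_le_segment_integral (u := u) (v := v)
  rw [hwt]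
  set F := ∫ t in (0 : ℝ)..1, f (seg t) with hFdef
  have hκρ : κ * ρ ≤ F * (X / 112) := by
    have : κ * ρ = (8 * κ * T) * (X / 112) := by rw [hρ, hX]; field_simp; ring
    rw [this]
    exact mul_le_mul_of_nonneg_right (h.le_fmin.trans hF) (by positivity)
  have hF0 : 0 ≤ F := h.fmin_pos.le.trans hF
  have hCle : C ≤ ℓ * (1 + X / 27) := by
    rw [hC, div_le_iff₀ hden]
    have : 0 ≤ ℓ * (X * (1 - X)) := by have := sub_nonneg.2 hX1; positivity
    nlinarith
  have hX20 : ℓ ^ 2 / (20 * T ^ 2) = X / 20 := by rw [hX]; field_simp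
  rw [hX20]
  calc (F + κ * ρ) * C ≤ (F + F * (X / 112)) * (ℓ * (1 + X / 27)) := by gcongr
    _ = (1 + X / 112) * (1 + X / 27) * (ℓ * F) := by ring
    _ ≤ (1 + X / 20) * (ℓ * F) := by
      gcongr
      nlinarith

theorem ofReal_le_conformalDist (h : AdmissibleScale M f κ fmin T) {c : ℝ}
    (hc : ∀ a b γ, IsLipschitzPath M u v a b γ → c ≤ ∫ t in a..b, f (γ t) * ‖deriv γ t‖) :
    ENNReal.ofReal c ≤ conformalDist M f u v := by
  refine le_iInf fun a => le_iInf fun b => le_iInf fun γ => le_iInf fun hγ => ?_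
  rw [hγ.conformalLength_eq h.lip.continuous fun x => (h.f_pos x).le]
  exact ENNReal.ofReal_le_ofReal (hc a b γ hγ)

theorem fmin_mul_le_conformalDist (h : AdmissibleScale M f κ fmin T)
    (u v : EuclideanSpace ℝ (Fin N)) :
    ENNReal.ofReal (fmin * ‖u - v‖) ≤ conformalDist M f u v := by
  refine h.ofReal_le_conformalDist fun a b γ hγ => ?_
  obtain ⟨K, hK⟩ := hγ.lipschitz
  have h1 := hK.norm_sub_le_integral_norm_deriv hγ.lt.le
  rw [hγ.source, hγ.target, norm_sub_rev] at h1
  refine (mul_le_mul_of_nonneg_left h1 h.fmin_pos.le).trans ?_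
  rw [← intervalIntegral.integral_const_mul]
  refine intervalIntegral.integral_mono_on hγ.lt.le
    ((hK.intervalIntegrable_norm_deriv hγ.lt.le).const_mul _)
    (hK.intervalIntegrable_mul_norm_deriv hγ.lt.le
      (h.lip.continuous.comp_continuousOn hK.continuousOn)) fun t _ => ?_
  exact mul_le_mul_of_nonneg_right (h.fmin_le _) (norm_nonneg _)

theorem weight_div_le_conformalDist (h : AdmissibleScale M f κ fmin T) (huv : ‖u - v‖ ≤ T) :
    ENNReal.ofReal (weight f ⊤ u v / (1 + ‖u - v‖ ^ 2 / (256 * T ^ 2)))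
      ≤ conformalDist M f u v := by
  refine h.ofReal_le_conformalDist fun a b γ hγ => ?_
  obtain ⟨K, hK⟩ := hγ.lipschitz
  have hT := h.pos
  rw [norm_sub_rev] at huv
  have h1 := hK.chord_integral_le_mul h.lip h.fmin_pos h.fmin_le hT h.le_fmin hγ.lt.le
    (by rwa [hγ.source, hγ.target])
  rw [hγ.source, hγ.target, norm_sub_rev] at h1
  rw [div_le_iff₀ (by positivity), mul_comm _ (1 + _)]
  exact h1

theorem conformalDist_ne_top (h : AdmissibleScale M f κ fmin T)
    (hu : u ∈ M) (hv : v ∈ M) : conformalDist M f u v ≠ ⊤ := by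
  have hT := h.pos
  have hlocal : ∀ x ∈ M, ∀ y ∈ M, dist x y < T → conformalDist M f x y < ⊤ :=
    fun x hx y hy hxy => (h.conformalDist_le hx hy (by rw [← dist_eq_norm]; exact hxy.le)).trans_lt
      ENNReal.ofReal_lt_top
  refine (h.conn.isConnected.isPreconnected.induction₂' (fun x y => conformalDist M f x y < ⊤)
    (fun x hx => ?_) (fun x y z _ _ _ h1 h2 => (conformalDist_triangle x y z).trans_lt
      (ENNReal.add_lt_top.2 ⟨h1, h2⟩)) hu hv).ne
  filter_upwards [self_mem_nhdsWithin, nhdsWithin_le_nhds (Metric.ball_mem_nhds x hT)] with y hy hd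
  exact ⟨hlocal x hx y hy (by rw [dist_comm]; exact hd), hlocal y hy x hx hd⟩

end AdmissibleScale

end ConformalGraph

/-! ### The trapezoidal rule and averages over segments -/

section Trapezoid

theorem LipschitzWith.abs_integral_sub_left_le {g : ℝ → ℝ} {L : ℝ≥0} (hg : LipschitzWith L g)
    {a b : ℝ} (hab : a ≤ b) : |(∫ t in a..b, g t) - (b - a) * g a| ≤ L * (b - a) ^ 2 / 2 := by
  have hi : IntervalIntegrable g volume a b := hg.continuous.intervalIntegrable a b
  have e : (∫ t in a..b, g t) - (b - a) * g a = ∫ t in a..b, (g t - g a) := by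
    rw [intervalIntegral.integral_sub hi intervalIntegrable_const]
    simp
  have e2 : ∫ t in a..b, (L : ℝ) * (t - a) = L * (b - a) ^ 2 / 2 := by
    rw [intervalIntegral.integral_const_mul, intervalIntegral.integral_sub
      intervalIntegral.intervalIntegrable_id intervalIntegrable_const, integral_id]
    simp only [intervalIntegral.integral_const, smul_eq_mul]
    ring
  rw [e, ← e2, ← Real.norm_eq_abs]
  refine intervalIntegral.norm_integral_le_of_norm_le hab
    (Filter.Eventually.of_forall fun t ht => ?_) (Continuous.intervalIntegrable (by fun_prop) _ _)
  have := hg.dist_le_mul t a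
  rwa [Real.dist_eq, Real.dist_eq, abs_of_nonneg (by linarith [ht.1] : 0 ≤ t - a)] at this

theorem LipschitzWith.abs_integral_sub_right_le {g : ℝ → ℝ} {L : ℝ≥0} (hg : LipschitzWith L g)
    {a b : ℝ} (hab : a ≤ b) : |(∫ t in a..b, g t) - (b - a) * g b| ≤ L * (b - a) ^ 2 / 2 := by
  have hg' : LipschitzWith L fun t => g (-t) :=
    LipschitzWith.of_dist_le_mul fun s t => by simpa using hg.dist_le_mul (-s) (-t)
  have h := hg'.abs_integral_sub_left_le (neg_le_neg hab)
  rw [intervalIntegral.integral_comp_neg] at h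
  simpa [neg_add_eq_sub] using h

/-- One step of the trapezoidal rule: each half of the interval is compared with the value at the
nearer end point. -/
theorem LipschitzWith.abs_integral_sub_trapezoid_le {g : ℝ → ℝ} {L : ℝ≥0} (hg : LipschitzWith L g)
    {a b : ℝ} (hab : a ≤ b) :
    |(∫ t in a..b, g t) - (b - a) * (g a + g b) / 2| ≤ L * (b - a) ^ 2 / 4 := by
  have hi : ∀ a b : ℝ, IntervalIntegrable g volume a b := fun a b =>
    hg.continuous.intervalIntegrable a b
  have h1 := hg.abs_integral_sub_left_le (by linarith : a ≤ (a + b) / 2)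
  have h2 := hg.abs_integral_sub_right_le (by linarith : (a + b) / 2 ≤ b)
  rw [← intervalIntegral.integral_add_adjacent_intervals (hi a ((a + b) / 2)) (hi _ b)]
  rw [abs_le] at h1 h2 ⊢
  constructor <;> nlinarith

theorem sum_range_add_succ_eq (a : ℕ → ℝ) (m : ℕ) :
    ∑ j ∈ Finset.range (m + 1), (a j + a (j + 1))
      = a 0 + 2 * ∑ k ∈ Finset.Icc 2 (m + 1), a (k - 1) + a (m + 1) := by
  induction m with
  | zero => simp
  | succ m ih =>
    rw [Finset.sum_range_succ, ih, Finset.sum_Icc_succ_top (by omega : 2 ≤ m + 1 + 1)]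
    simp only [Nat.add_sub_cancel]
    ring

theorem LipschitzWith.abs_integral_sub_trapezoid_sum_le {g : ℝ → ℝ} {L : ℝ≥0}
    (hg : LipschitzWith L g) (m : ℕ) :
    |(∫ t in (0 : ℝ)..1, g t) - (g 0 + 2 * ∑ k ∈ Finset.Icc 2 (m + 1),
        g (((k - 1 : ℕ) : ℝ) / (m + 1)) + g 1) / (2 * (m + 1))| ≤ L / (4 * (m + 1)) := by
  have hm : (0 : ℝ) < m + 1 := by positivity
  set a : ℕ → ℝ := fun j => (j : ℝ) / (m + 1) with ha
  have hstep : ∀ j, a (j + 1) - a j = 1 / (m + 1) := by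
    intro j; simp only [ha]; push_cast; field_simp; ring
  have h0 : a 0 = 0 := by simp [ha]
  have h1 : a (m + 1) = 1 := by simp only [ha]; push_cast; field_simp
  have hS := sum_range_add_succ_eq (fun j => g (a j)) m
  simp only [h0, h1] at hS
  rw [← hS]
  have hI := intervalIntegral.sum_integral_adjacent_intervals (f := g) (μ := volume) (a := a)
    (n := m + 1) fun k _ => hg.continuous.intervalIntegrable _ _
  rw [h0, h1] at hI
  rw [← hI, Finset.sum_div, ← Finset.sum_sub_distrib]
  refine (Finset.abs_sum_le_sum_abs _ _).trans ?_
  calc ∑ j ∈ Finset.range (m + 1), |(∫ t in a j..a (j + 1), g t)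
        - (g (a j) + g (a (j + 1))) / (2 * (m + 1))|
      ≤ ∑ _j ∈ Finset.range (m + 1), L * (1 / ((m : ℝ) + 1)) ^ 2 / 4 := by
        refine Finset.sum_le_sum fun j _ => ?_
        have hle : a j ≤ a (j + 1) := by
          have : 0 < a (j + 1) - a j := by rw [hstep]; positivity
          linarith
        have h := hg.abs_integral_sub_trapezoid_le hle
        rw [hstep] at h
        refine le_of_eq_of_le ?_ h
        congr 2
        field_simp
    _ = L / (4 * (m + 1)) := by
        rw [Finset.sum_const, Finset.card_range, nsmul_eq_mul]
        push_cast
        field_simp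

end Trapezoid

section SegmentAverage

variable {V : Type*} [NormedAddCommGroup V] [NormedSpace ℝ V]

/-- The average of `f` over the segment from `u` to `v`. -/
noncomputable def segmentAverage (f : V → ℝ) (u v : V) : ℝ :=
  ∫ t in (0 : ℝ)..1, f ((1 - t) • u + t • v)

theorem segmentAverage_self (f : V → ℝ) (u : V) : segmentAverage f u u = f u := by
  simp [segmentAverage, ← add_smul]

theorem LipschitzWith.abs_segmentAverage_sub_le {f : V → ℝ} {κ : ℝ≥0} (hf : LipschitzWith κ f)
    (u v u' v' : V) :
    |segmentAverage f u v - segmentAverage f u' v'| ≤ κ * (‖u - u'‖ + ‖v - v'‖) / 2 := by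
  have hc : ∀ u v : V, IntervalIntegrable (fun t : ℝ => f ((1 - t) • u + t • v)) volume 0 1 :=
    fun u v => (hf.continuous.comp (by fun_prop)).intervalIntegrable _ _
  rw [segmentAverage, segmentAverage, ← intervalIntegral.integral_sub (hc u v) (hc u' v')]
  have e : ∫ t in (0 : ℝ)..1, κ * ((1 - t) * ‖u - u'‖ + t * ‖v - v'‖)
      = κ * (‖u - u'‖ + ‖v - v'‖) / 2 := by
    rw [intervalIntegral.integral_const_mul, intervalIntegral.integral_add
      (Continuous.intervalIntegrable (by fun_prop) _ _)
      (Continuous.intervalIntegrable (by fun_prop) _ _), intervalIntegral.integral_mul_const,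
      intervalIntegral.integral_mul_const, intervalIntegral.integral_sub
      intervalIntegrable_const intervalIntegral.intervalIntegrable_id, integral_id]
    simp only [intervalIntegral.integral_const, smul_eq_mul]
    ring
  rw [← e, ← Real.norm_eq_abs]
  refine intervalIntegral.norm_integral_le_of_norm_le zero_le_one
    (Filter.Eventually.of_forall fun t ht => ?_) (Continuous.intervalIntegrable (by fun_prop) _ _)
  have h1 := hf.dist_le_mul ((1 - t) • u + t • v) ((1 - t) • u' + t • v')
  rw [dist_eq_norm, dist_eq_norm] at h1
  refine h1.trans (mul_le_mul_of_nonneg_left ?_ κ.coe_nonneg)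
  have e2 : (1 - t) • u + t • v - ((1 - t) • u' + t • v')
      = (1 - t) • (u - u') + t • (v - v') := by module
  rw [e2]
  refine (norm_add_le _ _).trans ?_
  rw [norm_smul, norm_smul, Real.norm_of_nonneg ht.1.le,
    Real.norm_of_nonneg (by linarith [ht.2] : 0 ≤ 1 - t)]

theorem segmentAverage_split {f : V → ℝ} (hf : Continuous f) (u v : V) (θ : ℝ) :
    θ * segmentAverage f u ((1 - θ) • u + θ • v)
      + (1 - θ) * segmentAverage f ((1 - θ) • u + θ • v) v = segmentAverage f u v := by
  have hc : Continuous fun t : ℝ => f ((1 - t) • u + t • v) := hf.comp (by fun_prop)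
  have h1 : θ * segmentAverage f u ((1 - θ) • u + θ • v)
      = ∫ t in (0 : ℝ)..θ, f ((1 - t) • u + t • v) := by
    have := intervalIntegral.mul_integral_comp_mul_right (a := 0) (b := 1)
      (f := fun t : ℝ => f ((1 - t) • u + t • v)) θ
    rw [zero_mul, one_mul] at this
    rw [← this, segmentAverage]
    congr 3
    ext t
    congr 1
    module
  have h2 : (1 - θ) * segmentAverage f ((1 - θ) • u + θ • v) v
      = ∫ t in θ..1, f ((1 - t) • u + t • v) := by
    have := intervalIntegral.mul_integral_comp_mul_add (a := 0) (b := 1)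
      (f := fun t : ℝ => f ((1 - t) • u + t • v)) (1 - θ) θ
    rw [mul_zero, mul_one, zero_add, sub_add_cancel] at this
    rw [← this, segmentAverage]
    congr 3
    ext t
    congr 1
    module
  rw [h1, h2]
  exact intervalIntegral.integral_add_adjacent_intervals (hc.intervalIntegrable _ _)
    (hc.intervalIntegrable _ _)

end SegmentAverage

namespace ConformalGraph

variable {N : ℕ} {f : EuclideanSpace ℝ (Fin N) → ℝ} {κ : ℝ≥0}

theorem weight_top (f : EuclideanSpace ℝ (Fin N) → ℝ) (x y : EuclideanSpace ℝ (Fin N)) :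
    weight f ⊤ x y = ‖x - y‖ * segmentAverage f x y := rfl

/-- The mesh `1 / (q - 1)` of the subdivision of the unit interval by `q` points; it is `0` for
`q = ∞`. -/
noncomputable def mesh (q : ℕ∞) : ℝ := ((q : ℝ≥0∞) - 1)⁻¹.toReal

theorem mesh_nonneg (q : ℕ∞) : 0 ≤ mesh q := ENNReal.toReal_nonneg

theorem mesh_natCast (m : ℕ) : mesh ((m + 2 : ℕ) : ℕ∞) = 1 / (m + 1) := by
  have : (((m + 2 : ℕ) : ℕ∞) : ℝ≥0∞) - 1 = ((m + 1 : ℕ) : ℝ≥0∞) := by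
    rw [ENat.toENNReal_coe]
    push_cast
    rw [← one_add_one_eq_two, ← add_assoc, ENNReal.add_sub_cancel_right (by simp)]
  rw [mesh, this, ENNReal.toReal_inv, ENNReal.toReal_natCast]
  push_cast
  rw [one_div]

theorem mesh_le_one {q : ℕ∞} (hq : 2 ≤ q) : mesh q ≤ 1 := by
  induction q using ENat.recTopCoe with
  | top => simp [mesh]
  | coe n =>
    obtain ⟨m, rfl⟩ : ∃ m, n = m + 2 := ⟨n - 2, by have : 2 ≤ n := by exact_mod_cast hq
                                                   omega⟩
    rw [mesh_natCast, div_le_one (by positivity)]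
    linarith [(Nat.cast_nonneg m : (0 : ℝ) ≤ m)]

/-- The error of the trapezoidal rule. -/
theorem abs_weight_sub_weight_top_le (hf : LipschitzWith κ f) {q : ℕ∞} (hq : 2 ≤ q)
    (x y : EuclideanSpace ℝ (Fin N)) :
    |weight f q x y - weight f ⊤ x y| ≤ κ * ‖x - y‖ ^ 2 / 4 * mesh q := by
  induction q using ENat.recTopCoe with
  | top => simp [mesh]
  | coe n =>
    obtain ⟨m, rfl⟩ : ∃ m, n = m + 2 := ⟨n - 2, by have : 2 ≤ n := by exact_mod_cast hq
                                                   omega⟩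
    have hm : (0 : ℝ) < m + 1 := by positivity
    set g : ℝ → ℝ := fun t => f ((1 - t) • x + t • y) with hg
    have hgL : LipschitzWith (κ * ‖x - y‖₊) g := by
      refine LipschitzWith.of_dist_le_mul fun s t => ?_
      refine (hf.dist_le_mul _ _).trans_eq ?_
      have e : (1 - s) • x + s • y - ((1 - t) • x + t • y) = (t - s) • (x - y) := by module
      rw [dist_eq_norm, e, norm_smul, Real.dist_eq, Real.norm_eq_abs, abs_sub_comm]
      push_cast
      ring
    have h := hgL.abs_integral_sub_trapezoid_sum_le m
    have e : weight f ((m + 2 : ℕ) : ℕ∞) x y = ‖x - y‖ * ((g 0 + 2 * ∑ k ∈ Finset.Icc 2 (m + 1),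
        g (((k - 1 : ℕ) : ℝ) / (m + 1)) + g 1) / (2 * (m + 1))) := by
      have e1 : weight f ((m + 2 : ℕ) : ℕ∞) x y = ‖x - y‖ / (2 * (((m + 2 : ℕ) : ℝ) - 1)) *
        (f x + 2 * ∑ k ∈ Finset.Icc 2 (m + 2 - 1),
            f (((((m + 2 : ℕ) : ℝ) - (k : ℝ)) / (((m + 2 : ℕ) : ℝ) - 1)) • x
              + (((k : ℝ) - 1) / (((m + 2 : ℕ) : ℝ) - 1)) • y) + f y) := rfl
      have e2 : ((m + 2 : ℕ) : ℝ) - 1 = m + 1 := by push_cast; ring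
      rw [e1, e2, mul_div_assoc', div_mul_eq_mul_div]
      congr 3
      · congr 1
        · simp [hg]
        · congr 1
          refine Finset.sum_congr rfl fun k hk => ?_
          have hk1 : 1 ≤ k := by have := (Finset.mem_Icc.1 hk).1; omega
          simp only [hg]
          congr 3
          · push_cast [Nat.cast_sub hk1]; field_simp; ring
          · push_cast [Nat.cast_sub hk1]; rfl
      · simp [hg]
    have e3 : weight f ⊤ x y = ‖x - y‖ * ∫ t in (0 : ℝ)..1, g t := rfl
    rw [e, e3, ← mul_sub, abs_mul, abs_norm, abs_sub_comm, mesh_natCast]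
    refine (mul_le_mul_of_nonneg_left h (norm_nonneg _)).trans_eq ?_
    push_cast
    field_simp

end ConformalGraph

/-! ### Points between two points, and the turning of shortest paths -/

namespace ConformalGraph

open Set Filter

/-- The conformal distance as a real number, with the value `0` where it is infinite. -/
noncomputable def realDist {N : ℕ} (M : Set (EuclideanSpace ℝ (Fin N)))
    (f : EuclideanSpace ℝ (Fin N) → ℝ) (x y : EuclideanSpace ℝ (Fin N)) : ℝ :=
  (conformalDist M f x y).toReal

theorem realDist_nonneg {N : ℕ} {M : Set (EuclideanSpace ℝ (Fin N))}
    {f : EuclideanSpace ℝ (Fin N) → ℝ} {x y : EuclideanSpace ℝ (Fin N)} : 0 ≤ realDist M f x y :=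
  ENNReal.toReal_nonneg

/-- In a triangle with sides `a`, `b`, `c` whose unit directions along `a` and `b` differ by a
vector of length `ω`, a small excess `a + b - c` forces `ω` to be small. -/
theorem turning_le_of_excess_le {a b c T ω : ℝ} (ha : 0 < a) (hb : 0 < b) (hT : 0 < T) (hω : 0 ≤ ω)
    (hcs : c ≤ a + b) (hc : c ^ 2 = (a + b) ^ 2 - a * b * ω ^ 2)
    (hab : (a + b) ^ 2 ≤ 9 / 2 * (a * b))
    (hex : a + b - c ≤ a * b * ω / (16 * T) + (a + b) ^ 2 / T ^ 2 / 18 * (a + b)) :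
    ω ≤ 4 / 5 * ((a + b) / T) := by
  generalize hs : a + b = s at *
  have hs0 : 0 < s := by rw [← hs]; positivity
  have hsc : a * b * ω ^ 2 ≤ 2 * s * (s - c) := by nlinarith
  set y := s / T with hy
  have hy0 : 0 < y := by positivity
  have hab0 : 0 < a * b := by positivity
  generalize a * b = m at *
  have hfinal : ω ^ 2 ≤ ω * y / 8 + y ^ 2 / 2 := by
    refine le_of_mul_le_mul_left ?_ hab0
    have e : m * ω / (16 * T) * (2 * s) = m * (ω * y / 8) := by
      rw [hy]; field_simp; ring
    have e' : s ^ 2 / T ^ 2 = y ^ 2 := by rw [hy, div_pow]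
    rw [e'] at hex
    calc m * ω ^ 2 ≤ 2 * s * (m * ω / (16 * T) + y ^ 2 / 18 * s) :=
          hsc.trans (mul_le_mul_of_nonneg_left hex (by positivity))
      _ = m * (ω * y / 8) + y ^ 2 / 9 * s ^ 2 := by rw [← e]; ring
      _ ≤ m * (ω * y / 8) + y ^ 2 / 9 * (9 / 2 * m) := by gcongr
      _ = _ := by ring
  by_contra! hlt
  nlinarith

namespace AdmissibleScale

variable {N : ℕ} {M : Set (EuclideanSpace ℝ (Fin N))} {f : EuclideanSpace ℝ (Fin N) → ℝ}
  {κ : ℝ≥0} {fmin T : ℝ} {u v w p : EuclideanSpace ℝ (Fin N)}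

theorem ofReal_realDist (h : AdmissibleScale M f κ fmin T) (hu : u ∈ M) (hv : v ∈ M) :
    ENNReal.ofReal (realDist M f u v) = conformalDist M f u v :=
  ENNReal.ofReal_toReal (h.conformalDist_ne_top hu hv)

theorem realDist_triangle (h : AdmissibleScale M f κ fmin T) (hu : u ∈ M) (hv : v ∈ M)
    (hw : w ∈ M) : realDist M f u w ≤ realDist M f u v + realDist M f v w := by
  have h1 := h.conformalDist_ne_top hu hv
  have h2 := h.conformalDist_ne_top hv hw
  rw [realDist, realDist, realDist, ← ENNReal.toReal_add h1 h2]
  exact ENNReal.toReal_mono (ENNReal.add_ne_top.2 ⟨h1, h2⟩) (conformalDist_triangle u v w)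

theorem fmin_mul_le_realDist (h : AdmissibleScale M f κ fmin T) (hu : u ∈ M) (hv : v ∈ M) :
    fmin * ‖u - v‖ ≤ realDist M f u v :=
  (ENNReal.ofReal_le_iff_le_toReal (h.conformalDist_ne_top hu hv)).1
    (h.fmin_mul_le_conformalDist u v)

theorem segmentAverage_ge (h : AdmissibleScale M f κ fmin T) (u v : EuclideanSpace ℝ (Fin N)) :
    fmin ≤ segmentAverage f u v :=
  h.fmin_le_segment_integral

theorem segmentAverage_pos (h : AdmissibleScale M f κ fmin T) (u v : EuclideanSpace ℝ (Fin N)) :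
    0 < segmentAverage f u v :=
  h.fmin_pos.trans_le (h.segmentAverage_ge u v)

theorem lipschitzConst_le (h : AdmissibleScale M f κ fmin T) (u v : EuclideanSpace ℝ (Fin N)) :
    κ ≤ segmentAverage f u v / (8 * T) := by
  have hT := h.pos
  rw [le_div_iff₀ (by positivity)]
  linarith [h.segmentAverage_ge u v, h.le_fmin]

theorem realDist_le (h : AdmissibleScale M f κ fmin T) (hu : u ∈ M) (hv : v ∈ M)
    (huv : ‖u - v‖ ≤ T) :
    realDist M f u v ≤ (1 + ‖u - v‖ ^ 2 / (20 * T ^ 2)) * weight f ⊤ u v := by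
  refine ENNReal.toReal_le_of_le_ofReal ?_ (h.conformalDist_le hu hv huv)
  have := (h.segmentAverage_pos u v).le
  rw [weight_top]
  positivity

theorem weight_le_realDist (h : AdmissibleScale M f κ fmin T) (hu : u ∈ M) (hv : v ∈ M)
    (huv : ‖u - v‖ ≤ T) :
    weight f ⊤ u v ≤ (1 + ‖u - v‖ ^ 2 / (256 * T ^ 2)) * realDist M f u v := by
  have := (ENNReal.ofReal_le_iff_le_toReal (h.conformalDist_ne_top hu hv)).1
    (h.weight_div_le_conformalDist huv)
  rw [mul_comm, ← div_le_iff₀ (by positivity)]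
  exact this

theorem realDist_self (h : AdmissibleScale M f κ fmin T) (hu : u ∈ M) : realDist M f u u = 0 := by
  refine le_antisymm ?_ ENNReal.toReal_nonneg
  simpa [weight_top] using h.realDist_le hu hu (by simp [h.pos.le])

theorem tendsto_realDist (h : AdmissibleScale M f κ fmin T) (hu : u ∈ M) :
    Tendsto (fun x => realDist M f u x) (nhdsWithin u M) (nhds 0) ∧
      Tendsto (fun x => realDist M f x u) (nhdsWithin u M) (nhds 0) := by
  have hT := h.pos
  set B : EuclideanSpace ℝ (Fin N) → ℝ := fun x => 2 * (‖x - u‖ * (f u + κ * ‖x - u‖)) with hB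
  have hBlim : Tendsto B (nhdsWithin u M) (nhds 0) := by
    have hc : Continuous B := by fun_prop
    have := (hc.tendsto u).mono_left (nhdsWithin_le_nhds (s := M))
    simpa [hB] using this
  have hnear : ∀ᶠ x in nhdsWithin u M, x ∈ M ∧ ‖x - u‖ < T := by
    filter_upwards [self_mem_nhdsWithin, nhdsWithin_le_nhds (Metric.ball_mem_nhds u hT)]
      with x hx hd
    exact ⟨hx, by rwa [← dist_eq_norm]⟩
  have key : ∀ x y : EuclideanSpace ℝ (Fin N), x ∈ M → y ∈ M → ‖x - y‖ < T →
      ‖x - u‖ + ‖y - u‖ = ‖x - y‖ →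
      realDist M f x y ≤ 2 * (‖x - y‖ * (f u + κ * ‖x - y‖)) := by
    intro x y hx hy hd hsum
    refine (h.realDist_le hx hy hd.le).trans ?_
    have h1 := h.lip.abs_segmentAverage_sub_le x y u u
    rw [segmentAverage_self, hsum] at h1
    have h2 : segmentAverage f x y ≤ f u + κ * ‖x - y‖ := by
      have := le_abs_self (segmentAverage f x y - f u)
      have : 0 ≤ κ * ‖x - y‖ := by positivity
      linarith
    have h3 : ‖x - y‖ ^ 2 / (20 * T ^ 2) ≤ 1 := by
      rw [div_le_one (by positivity)]
      nlinarith [norm_nonneg (x - y)]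
    have h4 := (h.segmentAverage_pos x y).le
    rw [weight_top]
    gcongr
    linarith
  constructor
  · refine squeeze_zero' (Eventually.of_forall fun _ => ENNReal.toReal_nonneg) ?_ hBlim
    filter_upwards [hnear] with x hx
    have := key u x hu hx.1 (by rw [norm_sub_rev]; exact hx.2) (by simp [norm_sub_rev])
    rwa [norm_sub_rev] at this
  · refine squeeze_zero' (Eventually.of_forall fun _ => ENNReal.toReal_nonneg) ?_ hBlim
    filter_upwards [hnear] with x hx
    exact key x u hx.1 hu hx.2 (by simp)

theorem continuousOn_realDist_add (h : AdmissibleScale M f κ fmin T) (hu : u ∈ M) (hv : v ∈ M) :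
    ContinuousOn (fun x => realDist M f u x + realDist M f x v) M := by
  intro p hp
  obtain ⟨h1, h2⟩ := h.tendsto_realDist hp
  refine ContinuousWithinAt.add ?_ ?_
  · rw [ContinuousWithinAt, tendsto_iff_dist_tendsto_zero]
    have h3 := h1.add h2
    rw [add_zero] at h3
    refine squeeze_zero' (Eventually.of_forall fun _ => dist_nonneg) ?_ h3
    filter_upwards [self_mem_nhdsWithin] with x hx
    have i1 := h.realDist_triangle hu hp hx
    have i2 := h.realDist_triangle hu hx hp
    have j1 : 0 ≤ realDist M f p x := ENNReal.toReal_nonneg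
    have j2 : 0 ≤ realDist M f x p := ENNReal.toReal_nonneg
    rw [Real.dist_eq, abs_le]
    constructor <;> linarith
  · rw [ContinuousWithinAt, tendsto_iff_dist_tendsto_zero]
    have h3 := h1.add h2
    rw [add_zero] at h3
    refine squeeze_zero' (Eventually.of_forall fun _ => dist_nonneg) ?_ h3
    filter_upwards [self_mem_nhdsWithin] with x hx
    have i1 := h.realDist_triangle hp hx hv
    have i2 := h.realDist_triangle hx hp hv
    have j1 : 0 ≤ realDist M f p x := ENNReal.toReal_nonneg
    have j2 : 0 ≤ realDist M f x p := ENNReal.toReal_nonneg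
    rw [Real.dist_eq, abs_le]
    constructor <;> linarith

/-- Points between `u` and `v` for the conformal distance exist at every Euclidean distance from `u`
up to `‖u - v‖`: nearly shortest paths cross the sphere about `u`, and this sphere is compact. -/
theorem exists_realDist_add_eq (h : AdmissibleScale M f κ fmin T) (hu : u ∈ M) (hv : v ∈ M)
    {l : ℝ} (hl : 0 < l) (hluv : l ≤ ‖u - v‖) :
    ∃ p ∈ M, ‖u - p‖ = l ∧ realDist M f u p + realDist M f p v = realDist M f u v := by
  set S := M ∩ Metric.sphere u l with hS
  have hScpt : IsCompact S := (isCompact_sphere u l).inter_left h.closed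
  have key : ∀ η : ℝ, 0 < η →
      ∃ p ∈ S, realDist M f u p + realDist M f p v ≤ realDist M f u v + η := by
    intro η hη
    rcases hluv.eq_or_lt with he | hlt
    · refine ⟨v, ⟨hv, ?_⟩, by rw [h.realDist_self hv]; linarith⟩
      rw [mem_sphere_iff_norm, norm_sub_rev, he]
    have hfin := h.conformalDist_ne_top hu hv
    obtain ⟨a, b, γ, hγ, hlen⟩ := exists_isLipschitzPath_lt
      (ENNReal.lt_add_right hfin (ENNReal.ofReal_pos.2 hη).ne')
    obtain ⟨K, hK⟩ := hγ.lipschitz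
    have hcont : ContinuousOn (fun t => ‖u - γ t‖) (Icc a b) :=
      (continuousOn_const.sub hK.continuousOn).norm
    obtain ⟨t, ht, htl⟩ := intermediate_value_Icc hγ.lt.le hcont
      (show l ∈ Icc ‖u - γ a‖ ‖u - γ b‖ by
        rw [hγ.source, hγ.target, sub_self, norm_zero]; exact ⟨hl.le, hluv⟩)
    simp only at htl
    have hat : a < t := by
      refine lt_of_le_of_ne ht.1 ?_
      rintro rfl
      rw [hγ.source, sub_self, norm_zero] at htl
      exact hl.ne htl
    have htb : t < b := by
      refine lt_of_le_of_ne ht.2 ?_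
      rintro rfl
      rw [hγ.target] at htl
      exact hlt.ne htl.symm
    have hpM : γ t ∈ M := hγ.mapsTo ht
    refine ⟨γ t, ⟨hpM, by rw [mem_sphere_iff_norm, norm_sub_rev, htl]⟩, ?_⟩
    have h1 := (hγ.conformalDist_add_le (f := f) hat htb).trans hlen.le
    rw [← h.ofReal_realDist hu hpM, ← h.ofReal_realDist hpM hv, ← h.ofReal_realDist hu hv,
      ← ENNReal.ofReal_add realDist_nonneg realDist_nonneg,
      ← ENNReal.ofReal_add realDist_nonneg hη.le] at h1
    exact (ENNReal.ofReal_le_ofReal_iff (add_nonneg realDist_nonneg hη.le)).1 h1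
  obtain ⟨p₀, hp₀, -⟩ := key 1 one_pos
  obtain ⟨p, hp, hmin⟩ := hScpt.exists_isMinOn ⟨p₀, hp₀⟩
    ((h.continuousOn_realDist_add hu hv).mono inter_subset_left)
  refine ⟨p, hp.1, by rw [norm_sub_rev]; exact mem_sphere_iff_norm.1 hp.2,
    le_antisymm (le_of_forall_pos_le_add fun η hη => ?_) (h.realDist_triangle hu hp.1 hv)⟩
  obtain ⟨q, hq, hle⟩ := key η hη
  exact (hmin hq).trans hle

theorem weight_add_weight_le (h : AdmissibleScale M f κ fmin T) (hu : u ∈ M) (hp : p ∈ M)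
    (hv : v ∈ M) (hT : ‖p - u‖ + ‖v - p‖ ≤ T)
    (hd : realDist M f u p + realDist M f p v ≤ realDist M f u v) :
    weight f ⊤ u p + weight f ⊤ p v
      ≤ (1 + (‖p - u‖ + ‖v - p‖) ^ 2 / T ^ 2 / 18)
          * ((‖p - u‖ + ‖v - p‖) * segmentAverage f u v)
        - (‖p - u‖ + ‖v - p‖ - ‖v - u‖) * segmentAverage f u v := by
  have hT0 := h.pos
  have hF0 := h.segmentAverage_pos u v
  have hcs : ‖v - u‖ ≤ ‖p - u‖ + ‖v - p‖ := by
    have : v - u = (p - u) + (v - p) := by abel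
    rw [this]; exact norm_add_le _ _
  have k1 := h.weight_le_realDist hu hp (by rw [norm_sub_rev]; linarith [norm_nonneg (v - p)])
  have k2 := h.weight_le_realDist hp hv (by rw [norm_sub_rev]; linarith [norm_nonneg (p - u)])
  have k3 := h.realDist_le hu hv (by rw [norm_sub_rev]; exact hcs.trans hT)
  have n1 : 0 ≤ realDist M f u p := realDist_nonneg
  have n2 : 0 ≤ realDist M f p v := realDist_nonneg
  rw [weight_top f u v] at k3
  rw [norm_sub_rev u p] at k1
  rw [norm_sub_rev p v] at k2
  rw [norm_sub_rev u v] at k3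
  have ha0 := norm_nonneg (p - u)
  have hb0 := norm_nonneg (v - p)
  have hc0 := norm_nonneg (v - u)
  generalize ‖p - u‖ = a at *
  generalize ‖v - p‖ = b at *
  generalize ‖v - u‖ = c at *
  generalize segmentAverage f u v = F at *
  generalize hs : a + b = s at *
  have hs0 : 0 ≤ s := by linarith
  set x := s ^ 2 / T ^ 2 with hx
  have hx0 : 0 ≤ x := by positivity
  have hx1 : x ≤ 1 := by rw [hx, div_le_one (by positivity)]; gcongr
  have hsmall : ∀ l : ℝ, 0 ≤ l → l ≤ s → ∀ k : ℝ, 0 < k → 1 + l ^ 2 / (k * T ^ 2) ≤ 1 + x / k := by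
    intro l hl0 hl k hk
    have : x / k = s ^ 2 / (k * T ^ 2) := by rw [hx]; field_simp
    rw [this]
    gcongr
  have m1 := k1.trans (mul_le_mul_of_nonneg_right
    (hsmall a ha0 (by linarith) 256 (by norm_num)) n1)
  have m2 := k2.trans (mul_le_mul_of_nonneg_right
    (hsmall b hb0 (by linarith) 256 (by norm_num)) n2)
  have m3 := k3.trans (mul_le_mul_of_nonneg_right
    (hsmall c hc0 hcs 20 (by norm_num)) (by positivity))
  clear_value x
  calc weight f ⊤ u p + weight f ⊤ p v
      ≤ (1 + x / 256) * (realDist M f u p + realDist M f p v) := by linarith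
    _ ≤ (1 + x / 256) * ((1 + x / 20) * (c * F)) := by
      gcongr
      exact hd.trans m3
    _ = c * F + ((1 + x / 256) * (1 + x / 20) - 1) * (c * F) := by ring
    _ ≤ c * F + x / 18 * (s * F) := by
      gcongr
      nlinarith
    _ = _ := by ring

/-- The discrete curvature bound: if `p` lies between `u` and `v` for the conformal distance and
`s = ‖p - u‖ + ‖v - p‖ ≤ T`, then the directions of `p - u` and `v - p` differ by at most
`(4 / 5) * s / T`. Indeed the conformal distances of the three pairs are the weights of the
segments up to second order, so `u`, `p`, `v` nearly realize equality in the triangle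
inequality. -/
theorem norm_direction_sub_le (h : AdmissibleScale M f κ fmin T) (hu : u ∈ M) (hp : p ∈ M)
    (hv : v ∈ M) {a b : ℝ} (ha : ‖p - u‖ = a) (hb : ‖v - p‖ = b) (ha0 : 0 < a) (hb0 : 0 < b)
    (hab : (a + b) ^ 2 ≤ 9 / 2 * (a * b)) (hT : a + b ≤ T)
    (hd : realDist M f u p + realDist M f p v ≤ realDist M f u v) :
    ‖a⁻¹ • (p - u) - b⁻¹ • (v - p)‖ ≤ 4 / 5 * ((a + b) / T) := by
  have hT0 := h.pos
  set s := a + b with hs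
  have hs0 : 0 < s := by positivity
  set e₁ := a⁻¹ • (p - u) with he₁
  set e₂ := b⁻¹ • (v - p) with he₂
  set ω := ‖e₁ - e₂‖ with hω
  have hω0 : 0 ≤ ω := norm_nonneg _
  have hpu : p - u = a • e₁ := by rw [he₁, smul_smul, mul_inv_cancel₀ ha0.ne', one_smul]
  have hvp : v - p = b • e₂ := by rw [he₂, smul_smul, mul_inv_cancel₀ hb0.ne', one_smul]
  have hn1 : ‖e₁‖ = 1 := by
    rw [he₁, norm_smul, ha, norm_inv, Real.norm_of_nonneg ha0.le, inv_mul_cancel₀ ha0.ne']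
  have hn2 : ‖e₂‖ = 1 := by
    rw [he₂, norm_smul, hb, norm_inv, Real.norm_of_nonneg hb0.le, inv_mul_cancel₀ hb0.ne']
  clear_value e₁ e₂
  set c := ‖v - u‖ with hc
  have hc0 : 0 ≤ c := norm_nonneg _
  have hω2 : ω ^ 2 = 2 - 2 * inner ℝ e₁ e₂ := by
    rw [hω, norm_sub_sq_real, hn1, hn2]; ring
  have hc2 : c ^ 2 = s ^ 2 - a * b * ω ^ 2 := by
    have : v - u = a • e₁ + b • e₂ := by rw [← hpu, ← hvp]; abel
    rw [hc, this, norm_add_sq_real, norm_smul, norm_smul, hn1, hn2, real_inner_smul_left,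
      real_inner_smul_right, Real.norm_of_nonneg ha0.le, Real.norm_of_nonneg hb0.le, hω2]
    ring
  have hcs : c ≤ s := by
    refine le_of_sq_le_sq ?_ hs0.le
    rw [hc2]
    have : 0 ≤ a * b * ω ^ 2 := by positivity
    linarith
  -- the point of the segment from `u` to `v` dividing it in the ratio `a : b`
  set θ := a / s with hθ
  have hθ1 : 1 - θ = b / s := by rw [hθ]; field_simp; rw [hs]; ring
  set p' := (1 - θ) • u + θ • v with hp'
  have hpp' : ‖p - p'‖ = a * b / s * ω := by
    have e : p - p' = (a * b / s) • (e₁ - e₂) := by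
      have h1 : p - p' = (1 - θ) • (p - u) - θ • (v - p) := by rw [hp']; module
      rw [h1, hpu, hvp, hθ1, hθ, smul_smul, smul_smul, smul_sub]
      congr 2 <;> ring
    rw [e, norm_smul, Real.norm_of_nonneg (by positivity)]
  set F := segmentAverage f u v with hF
  have hF0 : 0 < F := h.segmentAverage_pos u v
  have hκF : κ ≤ F / (8 * T) := h.lipschitzConst_le u v
  have hsplit : a * segmentAverage f u p' + b * segmentAverage f p' v = s * F := by
    have := segmentAverage_split h.lip.continuous u v θ
    rw [← hp', hθ1, hθ] at this
    rw [hF, ← this]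
    field_simp
  have hA1 : segmentAverage f u p' - κ * (a * b / s * ω) / 2 ≤ segmentAverage f u p := by
    have := h.lip.abs_segmentAverage_sub_le u p u p'
    rw [sub_self, norm_zero, zero_add, hpp'] at this
    linarith [(abs_le.1 this).1]
  have hA2 : segmentAverage f p' v - κ * (a * b / s * ω) / 2 ≤ segmentAverage f p v := by
    have := h.lip.abs_segmentAverage_sub_le p v p' v
    rw [sub_self, norm_zero, add_zero, hpp'] at this
    linarith [(abs_le.1 this).1]
  have hlow : s * F - κ * (a * b * ω) / 2 ≤ weight f ⊤ u p + weight f ⊤ p v := by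
    rw [weight_top, weight_top, norm_sub_rev u p, norm_sub_rev p v, ha, hb]
    have i1 := mul_le_mul_of_nonneg_left hA1 ha0.le
    have i2 := mul_le_mul_of_nonneg_left hA2 hb0.le
    have e : κ * (a * b * ω) / 2
        = a * (κ * (a * b / s * ω) / 2) + b * (κ * (a * b / s * ω) / 2) := by
      rw [← add_mul, ← hs]; field_simp
    rw [e]
    linarith
  have hup := h.weight_add_weight_le hu hp hv (by rwa [ha, hb]) hd
  rw [ha, hb, ← hs, ← hc, ← hF] at hup
  -- dividing by `F` leaves an inequality about the Euclidean triangle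
  refine turning_le_of_excess_le ha0 hb0 hT0 hω0 hcs hc2 hab ?_
  have h1 : κ * (a * b * ω) ≤ F / (8 * T) * (a * b * ω) := by gcongr
  have h2 : F / (8 * T) * (a * b * ω) = F * (2 * (a * b * ω / (16 * T))) := by
    generalize a * b * ω = m
    field_simp; ring
  refine le_of_mul_le_mul_left ?_ hF0
  linarith

end AdmissibleScale

end ConformalGraph

/-! ### Perturbation of an edge of a shortest path -/

namespace ConformalGraph

/-- The direction from `p` to `p'`, scaled by the average of `f` on the segment. -/
noncomputable def weightedDirection {N : ℕ} (f : EuclideanSpace ℝ (Fin N) → ℝ)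
    (p p' : EuclideanSpace ℝ (Fin N)) : EuclideanSpace ℝ (Fin N) :=
  segmentAverage f p p' • (‖p' - p‖⁻¹ • (p' - p))

/-- The norm is bounded above to second order by its linearization. -/
theorem norm_add_le_linear_add_sq {V : Type*} [NormedAddCommGroup V] [InnerProductSpace ℝ V]
    (w δ : V) (hw : 0 < ‖w‖) :
    ‖w + δ‖ ≤ ‖w‖ + inner ℝ (‖w‖⁻¹ • w) δ + ‖δ‖ ^ 2 / (2 * ‖w‖) := by
  have h1 := norm_add_sq_real w δ
  rw [real_inner_smul_left]
  have h2 : ‖w‖ + ‖w‖⁻¹ * inner ℝ w δ + ‖δ‖ ^ 2 / (2 * ‖w‖)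
      = (‖w + δ‖ ^ 2 + ‖w‖ ^ 2) / (2 * ‖w‖) := by
    rw [h1]; field_simp; ring
  rw [h2, le_div_iff₀ (by positivity)]
  nlinarith [sq_nonneg (‖w + δ‖ - ‖w‖)]

namespace AdmissibleScale

variable {N : ℕ} {M : Set (EuclideanSpace ℝ (Fin N))} {f : EuclideanSpace ℝ (Fin N) → ℝ}
  {κ : ℝ≥0} {fmin T : ℝ} {u v p p' p'' z z' : EuclideanSpace ℝ (Fin N)} {r ε : ℝ} {q : ℕ∞}

/-- The weight of a perturbed edge. The first-order effect of the perturbation is the inner product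
with `weightedDirection f p p'`, which telescopes along a path up to the turning of the path. -/
theorem weight_perturbed_le (h : AdmissibleScale M f κ fmin T) (hq : 2 ≤ q) (hp : p ∈ M)
    (hp' : p' ∈ M) (hr : 0 < r) (hε : 0 ≤ ε) (hεr : 4 * ε ≤ r)
    (h1 : r / 3 ≤ ‖p' - p‖) (h2 : ‖p' - p‖ ≤ 2 * r / 3) (hz : ‖z - p‖ ≤ ε) (hz' : ‖z' - p'‖ ≤ ε) :
    weight f q z z' ≤ (1 + 18 * (ε / r) ^ 2 + 5 / 16 * (ε / T))
        * (‖p' - p‖ * segmentAverage f p p')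
      + inner ℝ (weightedDirection f p p') ((z' - p') - (z - p))
      + r / (32 * T) * mesh q * (1 + 24 * (ε / r) ^ 2) * realDist M f p p' := by
  have hT := h.pos
  have hd := h.fmin_mul_le_realDist hp hp'
  rw [norm_sub_rev] at hd
  set δ := (z' - p') - (z - p) with hδ
  have hℓ0 : 0 < ‖p' - p‖ := by linarith
  have hδn : ‖δ‖ ≤ 2 * ε := (norm_sub_le _ _).trans (by linarith)
  have hzz : z' - z = (p' - p) + δ := by rw [hδ]; abel
  have hD1 := norm_add_le_linear_add_sq (p' - p) δ hℓ0
  have hD2 : ‖z' - z‖ ≤ ‖p' - p‖ + 2 * ε := by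
    rw [hzz]; exact (norm_add_le _ _).trans (by linarith)
  rw [← hzz] at hD1
  have hD0 := norm_nonneg (z' - z)
  have hF0 := h.segmentAverage_pos p p'
  have hκF : κ ≤ segmentAverage f p p' / (8 * T) := h.lipschitzConst_le p p'
  have hκf : κ ≤ fmin / (8 * T) := by
    rw [le_div_iff₀ (by positivity)]; linarith [h.le_fmin]
  have havg : segmentAverage f z z' ≤ segmentAverage f p p' + κ * ε := by
    have := (le_abs_self _).trans (h.lip.abs_segmentAverage_sub_le z z' p p')
    have := mul_le_mul_of_nonneg_left (add_le_add hz hz') κ.coe_nonneg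
    linarith
  have hquad := (abs_le.1 (abs_weight_sub_weight_top_le h.lip hq z z')).2
  rw [weight_top, norm_sub_rev z z'] at hquad
  rw [weightedDirection, real_inner_smul_left]
  set i := inner ℝ (‖p' - p‖⁻¹ • (p' - p)) δ with hi
  have hδsq : ‖δ‖ ^ 2 / (2 * ‖p' - p‖) ≤ 18 * (ε / r) ^ 2 * ‖p' - p‖ := by
    rw [div_le_iff₀ (by positivity)]
    calc ‖δ‖ ^ 2 ≤ (2 * ε) ^ 2 := by gcongr
      _ = 36 * (ε / r) ^ 2 * (r / 3) ^ 2 := by field_simp; ring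
      _ ≤ 36 * (ε / r) ^ 2 * ‖p' - p‖ ^ 2 := by gcongr
      _ = _ := by ring
  have hquad2 : κ * ‖z' - z‖ ^ 2 / 4 * mesh q
      ≤ r / (32 * T) * mesh q * (1 + 24 * (ε / r) ^ 2) * realDist M f p p' := by
    have hsq : ‖z' - z‖ ^ 2 ≤ ‖p' - p‖ * (r * (1 + 24 * (ε / r) ^ 2)) := by
      refine (pow_le_pow_left₀ hD0 hD2 2).trans ?_
      have e : r * (1 + 24 * (ε / r) ^ 2) = r + 24 * (ε ^ 2 / r) := by field_simp
      have e2 : ε ^ 2 / r * r = ε ^ 2 := by field_simp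
      have e3 : 0 ≤ ε ^ 2 / r := by positivity
      have e4 : 4 * ε ≤ r / 3 + 12 * (ε ^ 2 / r) := by
        have : r / 3 + 12 * (ε ^ 2 / r) - 4 * ε = (r - 6 * ε) ^ 2 / (3 * r) := by
          field_simp; ring
        have : 0 ≤ (r - 6 * ε) ^ 2 / (3 * r) := by positivity
        linarith
      rw [e]
      generalize ε ^ 2 / r = m at *
      nlinarith [mul_le_mul_of_nonneg_left e4 hℓ0.le, mul_le_mul_of_nonneg_left h1 e3]
    calc κ * ‖z' - z‖ ^ 2 / 4 * mesh q
        ≤ fmin / (8 * T) * (‖p' - p‖ * (r * (1 + 24 * (ε / r) ^ 2))) / 4 * mesh q := by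
          have := mesh_nonneg q
          have := h.fmin_pos
          gcongr
      _ = r / (32 * T) * mesh q * (1 + 24 * (ε / r) ^ 2) * (fmin * ‖p' - p‖) := by
          field_simp; ring
      _ ≤ _ := by
          have := mesh_nonneg q
          gcongr
  have hshift : ‖z' - z‖ * (κ * ε)
      ≤ 5 / 16 * (ε / T) * (‖p' - p‖ * segmentAverage f p p') := by
    calc ‖z' - z‖ * (κ * ε)
        ≤ (5 / 2 * ‖p' - p‖) * (segmentAverage f p p' / (8 * T) * ε) := by
          gcongr
          linarith
      _ = _ := by field_simp; ring
  have hmain : ‖z' - z‖ * segmentAverage f z z'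
      ≤ ‖z' - z‖ * (segmentAverage f p p' + κ * ε) := by gcongr
  have hlin : ‖z' - z‖ * segmentAverage f p p'
      ≤ (‖p' - p‖ + i + 18 * (ε / r) ^ 2 * ‖p' - p‖) * segmentAverage f p p' := by
    gcongr
    linarith
  linarith

/-- The first-order terms of consecutive edges nearly cancel. -/
theorem inner_weightedDirection_sub_le (h : AdmissibleScale M f κ fmin T) (hp : p ∈ M)
    (hp' : p' ∈ M) (hp'' : p'' ∈ M) (hr : 0 < r) (hrT : r ≤ T) (h1 : ‖p' - p‖ = r / 3)
    (h2 : r / 3 ≤ ‖p'' - p'‖) (h3 : ‖p'' - p'‖ ≤ 2 * r / 3) (hz : ‖z‖ ≤ ε)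
    (hd : realDist M f p p' + realDist M f p' p'' ≤ realDist M f p p'') :
    inner ℝ (weightedDirection f p p' - weightedDirection f p' p'') z
      ≤ 13 / 5 * (ε / T) * (‖p' - p‖ * segmentAverage f p p') := by
  have hT := h.pos
  have hε : 0 ≤ ε := (norm_nonneg z).trans hz
  have hF0 := h.segmentAverage_pos p p'
  have hκF : κ ≤ segmentAverage f p p' / (8 * T) := h.lipschitzConst_le p p'
  have hb0 : 0 < ‖p'' - p'‖ := by linarith
  have hturn := h.norm_direction_sub_le hp hp' hp'' rfl rfl (by rw [h1]; positivity) hb0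
    (by rw [h1]; nlinarith [mul_nonneg (sub_nonneg.2 h2) (sub_nonneg.2 h3)]) (by linarith) hd
  have hn2 : ‖‖p'' - p'‖⁻¹ • (p'' - p')‖ = 1 := by
    rw [norm_smul, norm_inv, norm_norm, inv_mul_cancel₀ hb0.ne']
  have hFF : |segmentAverage f p p' - segmentAverage f p' p''|
      ≤ segmentAverage f p p' / (16 * T) * (‖p' - p‖ + ‖p'' - p'‖) := by
    have i1 := h.lip.abs_segmentAverage_sub_le p p' p' p'
    have i2 := h.lip.abs_segmentAverage_sub_le p' p'' p' p'
    rw [segmentAverage_self, sub_self, norm_zero, add_zero, norm_sub_rev] at i1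
    rw [segmentAverage_self, sub_self, norm_zero, zero_add] at i2
    have i3 : |segmentAverage f p p' - segmentAverage f p' p''|
        ≤ κ * (‖p' - p‖ + ‖p'' - p'‖) / 2 := by
      rw [abs_le] at i1 i2 ⊢
      constructor <;> linarith
    refine i3.trans ?_
    calc κ * (‖p' - p‖ + ‖p'' - p'‖) / 2
        ≤ segmentAverage f p p' / (8 * T) * (‖p' - p‖ + ‖p'' - p'‖) / 2 := by gcongr
      _ = _ := by field_simp; ring
  have hvec : ‖weightedDirection f p p' - weightedDirection f p' p''‖
      ≤ segmentAverage f p p' * (4 / 5 * ((‖p' - p‖ + ‖p'' - p'‖) / T))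
        + segmentAverage f p p' / (16 * T) * (‖p' - p‖ + ‖p'' - p'‖) := by
    have e : weightedDirection f p p' - weightedDirection f p' p''
        = segmentAverage f p p' •
            (‖p' - p‖⁻¹ • (p' - p) - ‖p'' - p'‖⁻¹ • (p'' - p'))
          + (segmentAverage f p p' - segmentAverage f p' p'')
            • (‖p'' - p'‖⁻¹ • (p'' - p')) := by
      rw [weightedDirection, weightedDirection]; module
    rw [e]
    refine (norm_add_le _ _).trans ?_
    rw [norm_smul, norm_smul, hn2, mul_one, Real.norm_of_nonneg hF0.le, Real.norm_eq_abs]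
    gcongr
  refine (real_inner_le_norm _ _).trans ?_
  have hsum : ‖p' - p‖ + ‖p'' - p'‖ ≤ 3 * ‖p' - p‖ := by linarith
  calc _ ≤ (segmentAverage f p p' * (4 / 5 * ((‖p' - p‖ + ‖p'' - p'‖) / T))
        + segmentAverage f p p' / (16 * T) * (‖p' - p‖ + ‖p'' - p'‖)) * ε := by gcongr
    _ ≤ (segmentAverage f p p' * (4 / 5 * ((3 * ‖p' - p‖) / T))
        + segmentAverage f p p' / (16 * T) * (3 * ‖p' - p‖)) * ε := by gcongr
    _ = (207 / 80) * (ε / T) * (‖p' - p‖ * segmentAverage f p p') := by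
        field_simp; ring
    _ ≤ _ := mul_le_mul_of_nonneg_right
        (mul_le_mul_of_nonneg_right (by norm_num) (by positivity)) (by positivity)

/-- The sum of all relative errors of an edge. The mixed terms are split
by `(5 / 16 + 13 / 5) * (η * ρ) ≤ 22 * η ^ 2 + ρ ^ 2 / 10`, with `η = ε / r` and `ρ = r / T`. -/
theorem edge_error_le {d W Q : ℝ} (hT : 0 < T) (hr : 0 < r) (hrT : r ≤ T) (hε : 0 ≤ ε)
    (hQ0 : 0 ≤ Q) (hQ1 : Q ≤ 1) (hd : 0 ≤ d)
    (hW : W ≤ (1 + r ^ 2 / (256 * T ^ 2)) * d) :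
    (1 + 18 * (ε / r) ^ 2 + 5 / 16 * (ε / T)) * W + 13 / 5 * (ε / T) * W
        + r / (32 * T) * Q * (1 + 24 * (ε / r) ^ 2) * d
      ≤ (1 + (r / (32 * T) * Q + r ^ 2 / (8 * T ^ 2) + 56 * (ε / r) ^ 2)) * d := by
  set η := ε / r with hη
  set ρ := r / T with hρ
  have hη0 : 0 ≤ η := by positivity
  have hρ0 : 0 ≤ ρ := by positivity
  have hρ1 : ρ ≤ 1 := by rw [hρ, div_le_one hT]; exact hrT
  have e1 : ε / T = η * ρ := by rw [hη, hρ]; field_simp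
  have e2 : r ^ 2 / (256 * T ^ 2) = ρ ^ 2 / 256 := by rw [hρ]; field_simp
  have e3 : r / (32 * T) = ρ / 32 := by rw [hρ]; field_simp
  have e4 : r ^ 2 / (8 * T ^ 2) = ρ ^ 2 / 8 := by rw [hρ]; field_simp
  rw [e2] at hW
  rw [e1, e3, e4]
  clear_value η ρ
  have k1 : (1 + 18 * η ^ 2 + 5 / 16 * (η * ρ)) * W + 13 / 5 * (η * ρ) * W
      ≤ (1 + 40 * η ^ 2 + ρ ^ 2 / 10) * ((1 + ρ ^ 2 / 256) * d) := by
    have i1 : 1 + 18 * η ^ 2 + 5 / 16 * (η * ρ) + 13 / 5 * (η * ρ)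
        ≤ 1 + 40 * η ^ 2 + ρ ^ 2 / 10 := by
      nlinarith [sq_nonneg (15 * η - ρ), mul_nonneg hη0 hρ0]
    rw [← add_mul]
    refine (mul_le_mul_of_nonneg_left hW (by positivity)).trans ?_
    gcongr
  have k2 : (1 + 40 * η ^ 2 + ρ ^ 2 / 10) * (1 + ρ ^ 2 / 256)
      ≤ 1 + 41 * η ^ 2 + ρ ^ 2 / 8 := by
    have hρ2 : ρ ^ 2 ≤ 1 := by nlinarith
    nlinarith [mul_le_mul_of_nonneg_left hρ2 (sq_nonneg η),
      mul_le_mul_of_nonneg_left hρ2 (sq_nonneg ρ)]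
  have k3 : ρ / 32 * Q * (1 + 24 * η ^ 2) ≤ ρ / 32 * Q + η ^ 2 := by
    have : ρ * Q ≤ 1 := mul_le_one₀ hρ1 hQ0 hQ1
    nlinarith [mul_le_mul_of_nonneg_right this (sq_nonneg η)]
  have k4 := mul_le_mul_of_nonneg_right k2 hd
  have k5 := mul_le_mul_of_nonneg_right k3 hd
  have k6 : 0 ≤ η ^ 2 * d := by positivity
  linarith

end AdmissibleScale

end ConformalGraph

/-! ### Comparison of the polygonal metric with the conformal distance -/

namespace ConformalGraph

section Paths

variable {N : ℕ} {V : Set (EuclideanSpace ℝ (Fin N))} {r : ℝ}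
  {x y z : EuclideanSpace ℝ (Fin N)}

theorem IsBallGraphPath.single (hx : x ∈ V) (hy : y ∈ V) (hxy : ‖x - y‖ ≤ r) :
    IsBallGraphPath V r x y 1 (fun k => if k = 0 then x else y) where
  source := rfl
  target := rfl
  vertex k _ := by by_cases h : k = 0 <;> simp [h, hx, hy]
  edge k hk := by
    obtain rfl : k = 0 := by omega
    simpa using hxy

theorem IsBallGraphPath.cons {K : ℕ} {p : ℕ → EuclideanSpace ℝ (Fin N)}
    (h : IsBallGraphPath V r y z K p) (hx : x ∈ V) (hxy : ‖x - y‖ ≤ r) :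
    IsBallGraphPath V r x z (K + 1) (fun k => Nat.casesOn k x p) where
  source := rfl
  target := h.target
  vertex k hk := by
    cases k with
    | zero => exact hx
    | succ k => exact h.vertex k (by omega)
  edge k hk := by
    cases k with
    | zero => simpa [h.source] using hxy
    | succ k => exact h.edge k (by omega)

end Paths

namespace AdmissibleScale

variable {N : ℕ} {M : Set (EuclideanSpace ℝ (Fin N))} {f : EuclideanSpace ℝ (Fin N) → ℝ}
  {κ : ℝ≥0} {fmin T : ℝ} {x y u v p : EuclideanSpace ℝ (Fin N)} {r ε : ℝ} {q : ℕ∞}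
  {X : Set (EuclideanSpace ℝ (Fin N))}

/-- A graph path shadowing a shortest path, built backwards from `y`: the points `p`, `p'`, … of the
shortest path are at distance `r / 3` from each other, except for the last two, whose distance is
between `r / 3` and `2 * r / 3`. The vertex `z` of the graph path corresponding to `p` is left
variable, and its first-order effect on the total weight is recorded by an inner product, to be
compared with that of the preceding edge. Since `4 * ε ≤ r`, the edges have length at most
`r / 3 + 2 * ε ≤ r`, and the last one, which ends at `y` itself, at most `2 * r / 3 + ε ≤ r`. -/
theorem exists_ballGraphPath_shadowing (h : AdmissibleScale M f κ fmin T) (hq : 2 ≤ q)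
    (hr : 0 < r) (hrT : r ≤ T) (hε : 0 ≤ ε) (hεr : 4 * ε ≤ r)
    (hX : ∀ p ∈ M, ∃ z ∈ X, ‖z - p‖ ≤ ε) {V : Set (EuclideanSpace ℝ (Fin N))} (hXV : X ⊆ V)
    (hyV : y ∈ V) (hy : y ∈ M) (n : ℕ) :
    ∀ p ∈ M, r / 3 ≤ ‖y - p‖ → realDist M f p y ≤ n * (fmin * (r / 3)) →
      ∃ p' ∈ M, r / 3 ≤ ‖p' - p‖ ∧ ‖p' - p‖ ≤ 2 * r / 3 ∧
        realDist M f p p' + realDist M f p' y = realDist M f p y ∧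
        ∀ z ∈ V, ‖z - p‖ ≤ ε → ∃ K P, IsBallGraphPath V r z y K P ∧
          ∑ k ∈ Finset.range K, weight f q (P k) (P (k + 1))
            ≤ (1 + (r / (32 * T) * mesh q + r ^ 2 / (8 * T ^ 2) + 56 * (ε / r) ^ 2))
                * realDist M f p y - inner ℝ (weightedDirection f p p') (z - p) := by
  have hT := h.pos
  -- the weight of a segment of length at most `2 * r / 3`, at the scale `r`
  have hweight : ∀ a b, a ∈ M → b ∈ M → ‖b - a‖ ≤ 2 * r / 3 →
      ‖b - a‖ * segmentAverage f a b ≤ (1 + r ^ 2 / (256 * T ^ 2)) * realDist M f a b := by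
    intro a b ha hb hab
    have h1 := h.weight_le_realDist ha hb (by rw [norm_sub_rev]; linarith)
    rw [weight_top, norm_sub_rev] at h1
    refine h1.trans (mul_le_mul_of_nonneg_right ?_ realDist_nonneg)
    have : ‖b - a‖ ≤ r := by linarith
    gcongr
  have herr : ∀ a b, a ∈ M → b ∈ M → ‖b - a‖ ≤ 2 * r / 3 → _ := fun a b ha hb hab =>
    edge_error_le hT hr hrT hε (mesh_nonneg q) (mesh_le_one hq)
      (realDist_nonneg (M := M) (f := f) (x := a) (y := b)) (hweight a b ha hb hab)
  induction n with
  | zero =>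
    intro p hp hpy hd
    have h1 := h.fmin_mul_le_realDist hp hy
    rw [norm_sub_rev] at h1
    have h2 : 0 < fmin * ‖y - p‖ := mul_pos h.fmin_pos (by linarith)
    rw [Nat.cast_zero, zero_mul] at hd
    linarith
  | succ n ih =>
    intro p hp hpy hd
    rcases le_or_gt ‖y - p‖ (2 * r / 3) with hle | hlt
    · refine ⟨y, hy, hpy, hle, by rw [h.realDist_self hy, add_zero], fun z hz hzp => ?_⟩
      have hzy : ‖z - y‖ ≤ r := by
        have : z - y = (z - p) - (y - p) := by abel
        rw [this]
        exact (norm_sub_le _ _).trans (by linarith)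
      refine ⟨1, _, IsBallGraphPath.single hz hyV hzy, ?_⟩
      have h1 := h.weight_perturbed_le (z := z) (z' := y) hq hp hy hr hε hεr hpy hle hzp
        (by simpa using hε)
      have h2 := herr p y hp hy hle
      have h3 : 0 ≤ 13 / 5 * (ε / T) * (‖y - p‖ * segmentAverage f p y) := by
        have := h.segmentAverage_pos p y
        positivity
      rw [sub_self, zero_sub, inner_neg_right] at h1
      simp only [Finset.range_one, Finset.sum_singleton, if_true, zero_add, one_ne_zero, if_false]
      linarith
    · obtain ⟨p', hp', hpp', hdist⟩ := h.exists_realDist_add_eq hp hy (l := r / 3) (by positivity)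
        (by rw [norm_sub_rev]; linarith)
      rw [norm_sub_rev] at hpp'
      have hp'y : r / 3 ≤ ‖y - p'‖ := by
        have e : y - p = (y - p') + (p' - p) := by abel
        have := norm_add_le (y - p') (p' - p)
        rw [← e] at this
        linarith
      have hstep := h.fmin_mul_le_realDist hp hp'
      rw [norm_sub_rev, hpp'] at hstep
      obtain ⟨p'', hp'', h1, h2, h3, hpath⟩ := ih p' hp' hp'y (by push_cast at hd; linarith)
      have htri := h.realDist_triangle hp hp'' hy
      have hle : ‖p' - p‖ ≤ 2 * r / 3 := by linarith
      refine ⟨p', hp', hpp'.ge, hle, hdist, fun z hz hzp => ?_⟩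
      obtain ⟨z', hz'X, hz'p⟩ := hX p' hp'
      obtain ⟨K, P, hP, hcost⟩ := hpath z' (hXV hz'X) hz'p
      have hzz : ‖z - z'‖ ≤ r := by
        have : z - z' = (z - p) - (z' - p') - (p' - p) := by abel
        rw [this]
        exact (norm_sub_le _ _).trans (by linarith [norm_sub_le (z - p) (z' - p')])
      refine ⟨K + 1, _, hP.cons hz hzz, ?_⟩
      rw [Finset.sum_range_succ']
      simp only [hP.source]
      change _ + weight f q z z' ≤ _
      have k1 := h.weight_perturbed_le (z := z) (z' := z') hq hp hp' hr hε hεr hpp'.ge hle hzp hz'p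
      have k2 := h.inner_weightedDirection_sub_le hp hp' hp'' hr hrT hpp' h1 h2 hz'p (by linarith)
      have k3 := herr p p' hp hp' hle
      rw [inner_sub_right] at k1
      rw [inner_sub_left] at k2
      rw [← hdist, mul_add]
      linarith

/-- Upper bound for the polygonal metric. -/
theorem exists_ballGraphPath_le (h : AdmissibleScale M f κ fmin T) (hq : 2 ≤ q)
    (hr : 0 < r) (hrT : r ≤ T) (hε : 0 ≤ ε) (hεr : 4 * ε ≤ r)
    (hX : ∀ p ∈ M, ∃ z ∈ X, ‖z - p‖ ≤ ε) (hx : x ∈ M) (hy : y ∈ M) :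
    ∃ K P, IsBallGraphPath (X ∪ {x, y}) r x y K P ∧
      ∑ k ∈ Finset.range K, weight f q (P k) (P (k + 1))
        ≤ (1 + (r / (32 * T) * mesh q + r ^ 2 / (8 * T ^ 2) + 56 * (ε / r) ^ 2))
            * realDist M f x y := by
  have hT := h.pos
  have hxV : x ∈ X ∪ {x, y} := by simp
  have hyV : y ∈ X ∪ {x, y} := by simp
  rcases le_or_gt (r / 3) ‖y - x‖ with hle | hlt
  · obtain ⟨n, hn⟩ := exists_nat_ge (realDist M f x y / (fmin * (r / 3)))
    rw [div_le_iff₀ (mul_pos h.fmin_pos (by positivity))] at hn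
    obtain ⟨p', -, -, -, -, H⟩ := h.exists_ballGraphPath_shadowing hq hr hrT hε hεr hX
      Set.subset_union_left hyV hy n x hx hle hn
    obtain ⟨K, P, hP, hcost⟩ := H x hxV (by simpa using hε)
    exact ⟨K, P, hP, by simpa using hcost⟩
  · rw [norm_sub_rev] at hlt
    refine ⟨1, _, IsBallGraphPath.single hxV hyV (by linarith), ?_⟩
    simp only [Finset.range_one, Finset.sum_singleton, if_true, zero_add, one_ne_zero, if_false]
    have h1 := (abs_le.1 (abs_weight_sub_weight_top_le h.lip hq x y)).2
    have h2 := h.weight_le_realDist hx hy (by linarith)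
    have h3 := h.fmin_mul_le_realDist hx hy
    have hκf : κ ≤ fmin / (8 * T) := by
      rw [le_div_iff₀ (by positivity)]; linarith [h.le_fmin]
    have hQ := mesh_nonneg q
    have hf := h.fmin_pos
    have hd0 : 0 ≤ realDist M f x y := realDist_nonneg
    have h4 : κ * ‖x - y‖ ^ 2 / 4 * mesh q ≤ r / (32 * T) * mesh q * realDist M f x y := by
      calc κ * ‖x - y‖ ^ 2 / 4 * mesh q
          ≤ fmin / (8 * T) * (r * ‖x - y‖) / 4 * mesh q := by
            rw [sq]
            gcongr
            linarith
        _ = r / (32 * T) * mesh q * (fmin * ‖x - y‖) := by field_simp; ring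
        _ ≤ _ := by gcongr
    have h5 : ‖x - y‖ ^ 2 / (256 * T ^ 2) ≤ r ^ 2 / (8 * T ^ 2) := by
      have : ‖x - y‖ ≤ r := by linarith
      gcongr
      norm_num
    have h6 := mul_le_mul_of_nonneg_right h5 hd0
    have h7 : 0 ≤ 56 * (ε / r) ^ 2 * realDist M f x y := by positivity
    linarith

/-- Lower bound for the weight of an edge. -/
theorem mul_realDist_le_weight (h : AdmissibleScale M f κ fmin T) (hq : 2 ≤ q)
    (hrT : r ≤ T) (hu : u ∈ M) (hv : v ∈ M) (huv : ‖u - v‖ ≤ r) :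
    (1 - (r / (32 * T) * mesh q + r ^ 2 / (8 * T ^ 2))) * realDist M f u v ≤ weight f q u v := by
  have hT := h.pos
  have hr : 0 ≤ r := (norm_nonneg _).trans huv
  have h1 := (abs_le.1 (abs_weight_sub_weight_top_le h.lip hq u v)).1
  have h2 := h.realDist_le hu hv (huv.trans hrT)
  have h3 := h.fmin_mul_le_realDist hu hv
  have hκf : κ ≤ fmin / (8 * T) := by
    rw [le_div_iff₀ (by positivity)]; linarith [h.le_fmin]
  have hQ := mesh_nonneg q
  have hf := h.fmin_pos
  have hd0 : 0 ≤ realDist M f u v := realDist_nonneg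
  have h4 : κ * ‖u - v‖ ^ 2 / 4 * mesh q ≤ r / (32 * T) * mesh q * realDist M f u v := by
    calc κ * ‖u - v‖ ^ 2 / 4 * mesh q
        ≤ fmin / (8 * T) * (r * ‖u - v‖) / 4 * mesh q := by
          rw [sq]
          gcongr
      _ = r / (32 * T) * mesh q * (fmin * ‖u - v‖) := by field_simp; ring
      _ ≤ _ := by gcongr
  have hW0 : 0 ≤ weight f ⊤ u v := by
    have := (h.segmentAverage_pos u v).le
    rw [weight_top]; positivity
  have h5 : ‖u - v‖ ^ 2 / (20 * T ^ 2) ≤ r ^ 2 / (8 * T ^ 2) := by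
    gcongr
    norm_num
  have h6 : r ^ 2 / (8 * T ^ 2) ≤ 1 := by
    rw [div_le_one (by positivity)]; nlinarith
  have h7 : 0 ≤ r ^ 2 / (8 * T ^ 2) := by positivity
  have h8 : (1 - r ^ 2 / (8 * T ^ 2)) * realDist M f u v ≤ weight f ⊤ u v := by
    have h9 := h2.trans (mul_le_mul_of_nonneg_right (add_le_add_right h5 1) hW0)
    generalize r ^ 2 / (8 * T ^ 2) = m at *
    nlinarith [mul_le_mul_of_nonneg_left h9 (sub_nonneg.2 h6), mul_nonneg (sq_nonneg m) hW0]
  linarith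

/-- Lower bound for the weight of a path. -/
theorem mul_realDist_le_sum_weight (h : AdmissibleScale M f κ fmin T) (hq : 2 ≤ q)
    (hrT : r ≤ T) {V : Set (EuclideanSpace ℝ (Fin N))} (hVM : V ⊆ M) {K : ℕ}
    {P : ℕ → EuclideanSpace ℝ (Fin N)} (hP : IsBallGraphPath V r x y K P)
    (h1 : 0 ≤ 1 - (r / (32 * T) * mesh q + r ^ 2 / (8 * T ^ 2))) :
    (1 - (r / (32 * T) * mesh q + r ^ 2 / (8 * T ^ 2))) * realDist M f x y
      ≤ ∑ k ∈ Finset.range K, weight f q (P k) (P (k + 1)) := by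
  have key : ∀ m ≤ K, (1 - (r / (32 * T) * mesh q + r ^ 2 / (8 * T ^ 2))) * realDist M f x (P m)
      ≤ ∑ k ∈ Finset.range m, weight f q (P k) (P (k + 1)) := by
    have hx : x ∈ M := hVM (hP.source ▸ hP.vertex 0 (Nat.zero_le _))
    intro m
    induction m with
    | zero =>
      intro _
      rw [hP.source, h.realDist_self hx]
      simp
    | succ m ih =>
      intro hm
      have hPm : P m ∈ M := hVM (hP.vertex m (by omega))
      have hPm' : P (m + 1) ∈ M := hVM (hP.vertex (m + 1) hm)
      rw [Finset.sum_range_succ]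
      have i1 := ih (by omega)
      have i2 := h.mul_realDist_le_weight hq hrT hPm hPm' (hP.edge m (by omega))
      have i3 := mul_le_mul_of_nonneg_left (h.realDist_triangle hx hPm hPm') h1
      linarith
  have := key K le_rfl
  rwa [hP.target] at this

/-- The bound for the relative loss at a finite scale `T`. -/
theorem relLoss_le (h : AdmissibleScale M f κ fmin T) (hq : 2 ≤ q)
    (hr : 0 < r) (hrT : r ≤ T) (hε : 0 ≤ ε) (hεr : 4 * ε ≤ r) (hXM : X ⊆ M)
    (hX : ∀ p ∈ M, ∃ z ∈ X, ‖z - p‖ ≤ ε) :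
    relLoss M (polygonalDist X f r q) (conformalDist M f)
      ≤ ENNReal.ofReal (r / (32 * T) * mesh q + r ^ 2 / (8 * T ^ 2) + 56 * (ε / r) ^ 2) := by
  have hT := h.pos
  have hQ := mesh_nonneg q
  refine iSup_le fun x => iSup_le fun hx => iSup_le fun y => iSup_le fun hy => iSup_le fun hxy => ?_
  have hd0 : 0 < realDist M f x y :=
    (mul_pos h.fmin_pos (norm_pos_iff.2 (sub_ne_zero.2 hxy))).trans_le
      (h.fmin_mul_le_realDist hx hy)
  set E := r / (32 * T) * mesh q + r ^ 2 / (8 * T ^ 2) + 56 * (ε / r) ^ 2 with hE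
  have hE0 : 0 ≤ E := by positivity
  rw [← h.ofReal_realDist hx hy]
  have hne0 : ENNReal.ofReal (realDist M f x y) ≠ 0 := (ENNReal.ofReal_pos.2 hd0).ne'
  refine max_le ?_ ?_
  · rw [tsub_le_iff_right, ← tsub_le_iff_left]
    rw [ENNReal.le_div_iff_mul_le (Or.inl hne0) (Or.inl ENNReal.ofReal_ne_top),
      ← ENNReal.ofReal_one, ← ENNReal.ofReal_sub _ hE0]
    rcases le_or_gt (1 - E) 0 with hneg | hpos
    · rw [ENNReal.ofReal_of_nonpos hneg, zero_mul]
      exact zero_le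
    rw [← ENNReal.ofReal_mul hpos.le]
    refine le_iInf fun K => le_iInf fun P => le_iInf fun hP => ENNReal.ofReal_le_ofReal ?_
    have h56 : 0 ≤ 56 * (ε / r) ^ 2 := by positivity
    have hVM : X ∪ {x, y} ⊆ M := Set.union_subset hXM (by
      rintro w (rfl | rfl) <;> assumption)
    refine le_trans ?_ (h.mul_realDist_le_sum_weight hq hrT hVM hP (by linarith))
    exact mul_le_mul_of_nonneg_right (by linarith) hd0.le
  · rw [tsub_le_iff_right]
    refine ENNReal.div_le_of_le_mul ?_
    obtain ⟨K, P, hP, hcost⟩ := h.exists_ballGraphPath_le hq hr hrT hε hεr hX hx hy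
    refine (iInf_le_of_le K <| iInf_le_of_le P <| iInf_le _ hP).trans ?_
    rw [← ENNReal.ofReal_one, ← ENNReal.ofReal_add hE0 zero_le_one, add_comm E,
      ← ENNReal.ofReal_mul (by positivity)]
    exact ENNReal.ofReal_le_ofReal hcost

end AdmissibleScale

theorem admissibleScale_of_le_reachBound {N : ℕ} {M : Set (EuclideanSpace ℝ (Fin N))}
    (hMclosed : IsClosed M) (hMconn : IsPathConnected M) {f : EuclideanSpace ℝ (Fin N) → ℝ}
    {κ : ℝ≥0} (hfLip : LipschitzWith κ f) {fmin : ℝ} (hfmin : 0 < fmin) (hf : ∀ x, fmin ≤ f x)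
    {T : ℝ} (hT : 0 < T) (hTM : ENNReal.ofReal T ≤ reachBound M fmin κ) :
    AdmissibleScale M f κ fmin T where
  closed := hMclosed
  conn := hMconn
  pos := hT
  nearest := by
    refine uniqueNearest_of_le_reach hMconn.nonempty ?_
    have h1 : ENNReal.ofReal T ≤ reach M / 2 := hTM.trans (min_le_left _ _)
    rw [ENNReal.le_div_iff_mul_le (Or.inl two_ne_zero) (Or.inl ENNReal.ofNat_ne_top)] at h1
    rwa [ENNReal.ofReal_mul zero_le_two, ENNReal.ofReal_ofNat, mul_comm]
  lip := hfLip
  fmin_pos := hfmin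
  fmin_le := hf
  le_fmin := by
    have h1 : ENNReal.ofReal T ≤ ENNReal.ofReal fmin / (8 * (κ : ℝ≥0∞)) :=
      hTM.trans (min_le_right _ _)
    have h2 := ENNReal.mul_le_of_le_div h1
    have h3 : (8 * (κ : ℝ≥0∞)) = ENNReal.ofReal (8 * κ) := by
      rw [ENNReal.ofReal_mul (by norm_num), ENNReal.ofReal_coe_nnreal, ENNReal.ofReal_ofNat]
    rw [h3, ← ENNReal.ofReal_mul hT.le, ENNReal.ofReal_le_ofReal_iff hfmin.le] at h2
    linarith

theorem ofReal_mesh {q : ℕ∞} (hq : 2 ≤ q) : ENNReal.ofReal (mesh q) = ((q : ℝ≥0∞) - 1)⁻¹ := by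
  refine ENNReal.ofReal_toReal (ENNReal.inv_ne_top.2 ?_)
  have h2 : (2 : ℝ≥0∞) ≤ (q : ℝ≥0∞) := by exact_mod_cast ENat.toENNReal_le.2 hq
  exact (tsub_pos_of_lt (lt_of_lt_of_le (by norm_num) h2)).ne'

theorem exists_mem_norm_sub_le_of_hausdorffEDist {V : Type*} [NormedAddCommGroup V] {M X : Set V}
    (hne : M.Nonempty) (hXfin : X.Finite) (hfin : Metric.hausdorffEDist M X ≠ ⊤) :
    ∀ p ∈ M, ∃ z ∈ X, ‖z - p‖ ≤ (Metric.hausdorffEDist M X).toReal := by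
  intro p hp
  have hXne : X.Nonempty := Metric.nonempty_of_hausdorffEDist_ne_top hne hfin
  obtain ⟨z, hz, hd⟩ := hXfin.isCompact.exists_infEDist_eq_edist hXne p
  refine ⟨z, hz, ?_⟩
  have h1 : edist p z ≤ Metric.hausdorffEDist M X :=
    hd ▸ Metric.infEDist_le_hausdorffEDist_of_mem hp
  rw [← dist_eq_norm, dist_comm, dist_edist]
  exact ENNReal.toReal_mono hfin h1

end ConformalGraph

theorem mainTheorem2 {N : ℕ}
    (M : Set (EuclideanSpace ℝ (Fin N))) (hMclosed : IsClosed M) (hMconn : IsPathConnected M)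
    (hMreach : 0 < ConformalGraph.reach M)
    (f : EuclideanSpace ℝ (Fin N) → ℝ) (κ : ℝ≥0) (hfLip : LipschitzWith κ f)
    (fmin : ℝ) (hfmin : 0 < fmin) (hf : ∀ x, fmin ≤ f x)
    (X : Set (EuclideanSpace ℝ (Fin N))) (hXfin : X.Finite) (hXM : X ⊆ M)
    (r : ℝ) (hr : 0 < r) (q : ℕ∞) (hq : 2 ≤ q)
    (hXr : 4 * Metric.hausdorffEDist M X ≤ ENNReal.ofReal r)
    (hrT : ENNReal.ofReal r ≤ ConformalGraph.reachBound M fmin κ) :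
    ConformalGraph.relLoss M (ConformalGraph.polygonalDist X f r q)
        (ConformalGraph.conformalDist M f)
      ≤ ENNReal.ofReal r / (32 * ConformalGraph.reachBound M fmin κ * ((q : ℝ≥0∞) - 1))
        + ENNReal.ofReal r ^ 2 / (8 * ConformalGraph.reachBound M fmin κ ^ 2)
        + 56 * (Metric.hausdorffEDist M X ^ 2 / ENNReal.ofReal r ^ 2) := by
  have hHfin : Metric.hausdorffEDist M X ≠ ⊤ := by
    intro h
    rw [h, ENNReal.mul_top (by norm_num), top_le_iff] at hXr
    exact ENNReal.ofReal_ne_top hXr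
  set ε := (Metric.hausdorffEDist M X).toReal with hε
  have hε0 : 0 ≤ ε := ENNReal.toReal_nonneg
  have hεH : Metric.hausdorffEDist M X = ENNReal.ofReal ε := (ENNReal.ofReal_toReal hHfin).symm
  have hεr : 4 * ε ≤ r := by
    rw [hεH, ← ENNReal.ofReal_ofNat 4, ← ENNReal.ofReal_mul (by norm_num),
      ENNReal.ofReal_le_ofReal_iff hr.le] at hXr
    exact hXr
  have hX := ConformalGraph.exists_mem_norm_sub_le_of_hausdorffEDist hMconn.nonempty hXfin hHfin
  have hQ := ConformalGraph.mesh_nonneg q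
  have hbound : ∀ T : ℝ, r ≤ T → ENNReal.ofReal T ≤ ConformalGraph.reachBound M fmin κ →
      ConformalGraph.relLoss M (ConformalGraph.polygonalDist X f r q)
        (ConformalGraph.conformalDist M f)
        ≤ ENNReal.ofReal (r / (32 * T) * ConformalGraph.mesh q + r ^ 2 / (8 * T ^ 2)
            + 56 * (ε / r) ^ 2) := fun T hrT hT =>
    (ConformalGraph.admissibleScale_of_le_reachBound hMclosed hMconn hfLip hfmin hf
      (hr.trans_le hrT) hT).relLoss_le hq hr hrT hε0 hεr hXM hX
  have hlast : 56 * (Metric.hausdorffEDist M X ^ 2 / ENNReal.ofReal r ^ 2)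
      = ENNReal.ofReal (56 * (ε / r) ^ 2) := by
    rw [ENNReal.ofReal_mul (by norm_num), ENNReal.ofReal_ofNat, ENNReal.ofReal_pow (by positivity),
      ENNReal.ofReal_div_of_pos hr, hεH, div_eq_mul_inv, div_eq_mul_inv, mul_pow, ENNReal.inv_pow]
  rw [hlast]
  rcases eq_or_ne (ConformalGraph.reachBound M fmin κ) ⊤ with htop | hne
  · -- every finite scale is admissible, and the first two terms vanish as the scale grows
    refine le_trans ?_ le_add_self
    have hlim : Filter.Tendsto (fun T : ℝ => ENNReal.ofReal (r / (32 * T) * ConformalGraph.mesh q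
        + r ^ 2 / (8 * T ^ 2) + 56 * (ε / r) ^ 2)) Filter.atTop
        (nhds (ENNReal.ofReal (0 * ConformalGraph.mesh q + 0 + 56 * (ε / r) ^ 2))) := by
      refine ENNReal.tendsto_ofReal (((Filter.Tendsto.mul_const _ ?_).add ?_).add_const _)
      · exact Filter.Tendsto.const_div_atTop
          (Filter.tendsto_id.const_mul_atTop (by norm_num : (0 : ℝ) < 32)) r
      · exact Filter.Tendsto.const_div_atTop
          ((Filter.tendsto_pow_atTop two_ne_zero).const_mul_atTop (by norm_num : (0 : ℝ) < 8)) _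
    rw [zero_mul, zero_add, zero_add] at hlim
    refine ge_of_tendsto hlim ?_
    filter_upwards [Filter.eventually_ge_atTop r] with T hT
    exact hbound T hT (by rw [htop]; exact le_top)
  · set T := (ConformalGraph.reachBound M fmin κ).toReal with hTdef
    have hTeq : ConformalGraph.reachBound M fmin κ = ENNReal.ofReal T :=
      (ENNReal.ofReal_toReal hne).symm
    have hrT' : r ≤ T := (ENNReal.ofReal_le_iff_le_toReal hne).1 hrT
    have hT : 0 < T := hr.trans_le hrT'
    refine (hbound T hrT' hTeq.ge).trans_eq ?_
    rw [ENNReal.ofReal_add (by positivity) (by positivity),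
      ENNReal.ofReal_add (by positivity) (by positivity)]
    congr 2
    · rw [ENNReal.ofReal_mul (by positivity), ENNReal.ofReal_div_of_pos (by positivity),
        ENNReal.ofReal_mul (by norm_num), ConformalGraph.ofReal_mesh hq, ENNReal.ofReal_ofNat,
        ← hTeq, div_eq_mul_inv, div_eq_mul_inv, mul_assoc]
      congr 1
      refine (ENNReal.mul_inv (Or.inl (mul_ne_zero (by norm_num) ?_))
        (Or.inl (ENNReal.mul_ne_top (by norm_num) hne))).symm
      rw [hTeq]
      exact (ENNReal.ofReal_pos.2 hT).ne'
    · rw [ENNReal.ofReal_div_of_pos (by positivity), ENNReal.ofReal_mul (by norm_num),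
        ENNReal.ofReal_pow hr.le, ENNReal.ofReal_pow hT.le, ENNReal.ofReal_ofNat, ← hTeq]
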